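/- Conventions. For a finite set $\mathcal A$, let $\mathcal A^{\mathbb Z^2}$ carry the product topology of the discrete topology and the shift action $(\sigma^{\mathbf k}x)_{\mathbf m}=x_{\mathbf m+\mathbf k}$. A subshift is a closed set $X\subseteq\mathcal A^{\mathbb Z^2}$ with $\sigma^{\mathbf k}(X)=X$ for all $\mathbf k\in\mathbb Z^2$. A subshift $X$ is minimal if it contains no nonempty, proper, closed, shift-invariant subset, and aperiodic if it is nonempty and no $x\in X$ satisfies $\sigma^{\mathbf k}x=x$ for some $\mathbf k\neq\mathbf 0$. For a set $X$ write $\overline{X}^{\sigma}=\bigcup_{\mathbf k\in\mathbb Z^2}\sigma^{\mathbf k}(X)$. A Wang tile is a tuple $(\text{right},\text{top},\text{left},\text{bottom})$ of colours. For a list $\mathcal T=\{\tau_0,\dots,\tau_{n-1}\}$ of distinct Wang tiles, $\Omega_{\mathcal T}\subseteq\{0,\dots,n-1\}^{\mathbb Z^2}$ is the set of all $x$ such that $\text{right}(\tau_{x(\mathbf m)})=\text{left}(\tau_{x(\mathbf m+\mathbf e_1)})$ and $\text{top}(\tau_{x(\mathbf m)})=\text{bottom}(\tau_{x(\mathbf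 m+\mathbf e_2)})$ for all $\mathbf m\in\mathbb Z^2$. Let $\Omega_i=\Omega_{\mathcal T_i}$ for $0\le i\le 5$, where $\mathcal T_0$ is the Jeandel--Rao set of 11 Wang tiles and the tiles, with indices $0,1,2,\dots$ in the order written, are: $\mathcal T_0$: $(2,4,2,1),\ (2,2,2,0),\ (1,1,3,1),\ (1,2,3,2),\ (3,1,3,3),\ (0,1,3,1),\ (0,0,0,1),\ (3,1,0,2),\ (0,2,1,2),\ (1,2,1,4),\ (3,3,1,2)$. $\mathcal T_1$: $(1,1,3,1),\ (1,2,3,2),\ (3,1,3,3),\ (0,1,3,1),\ (0,0,0,1),\ (3,1,0,2),\ (0,2,1,2),\ (3,3,1,2),\ (21,2,21,1),\ (21,2,23,0),\ (23,1,20,0),\ (20,2,21,0),\ (23,3,21,0)$. $\mathcal T_2$: $(1,1,3,1),\ (1,2,3,2),\ (3,1,3,3),\ (0,1,3,1),\ (0,0,0,1),\ (3,1,0,2),\ (0,2,1,2),\ (3,3,1,2),\ (211,2,213,1),\ (213,1,210,1),\ (210,2,211,1),\ (213,3,211,1),\ (211,2,233,0),\ (213,1,230,0),\ (210,2,231,0),\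 (231,1,203,0),\ (230,1,203,0),\ (203,1,210,0),\ (203,3,211,0),\ (233,1,213,0)$. $\mathcal T_3$: $(3,1,3,3),\ (0,1,3,1),\ (0,0,0,1),\ (3,1,0,2),\ (2111,2,2133,1),\ (2113,1,2130,1),\ (2110,2,2131,1),\ (2131,1,2103,1),\ (2130,1,2103,1),\ (2103,1,2110,1),\ (2103,3,2111,1),\ (2133,1,2113,1),\ (2113,1,2330,0),\ (2110,2,2331,0),\ (2130,0,2300,0),\ (2103,1,2310,0),\ (2310,1,2033,0),\ (2300,1,2033,0),\ (2300,0,2030,0),\ (2030,1,2103,0),\ (2033,1,2113,0),\ (2331,1,2133,0),\ (2330,1,2133,0),\ (2330,0,2130,0)$. $\mathcal T_4$: $(2113,1,2130,1),\ (2130,1,2103,1),\ (2133,1,2113,1),\ (2113,1,2330,0),\ (2130,0,2300,0),\ (2103,1,2310,0),\ (2310,1,2033,0),\ (2300,1,2033,0),\ (2300,0,2030,0),\ (2030,1,2103,0),\ (2033,1,2113,0),\ (2330,1,2133,0),\ (2330,0,2130,0),\ (21113,1,21330,1),\ (21130,0,21300,1),\ (21103,1,21310,1),\ (21310,1,21033,1),\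 (21310,0,21030,1),\ (21300,1,21033,1),\ (21300,0,21030,1),\ (21030,1,21103,1),\ (21033,1,21113,1),\ (21330,0,21130,1),\ (21130,0,23300,0),\ (21030,0,23100,0),\ (23100,0,20330,0),\ (20330,0,21130,0),\ (23300,0,21330,0)$. $\mathcal T_5$: $(2113,5,2130,1),\ (2130,1,2103,5),\ (2133,1,2113,1),\ (2113,5,2330,0),\ (2130,6,2300,0),\ (2103,5,2310,0),\ (2310,1,2033,6),\ (2300,1,2033,6),\ (2300,0,2030,6),\ (2030,1,2103,0),\ (2033,1,2113,0),\ (2330,1,2133,6),\ (2330,0,2130,6),\ (21113,5,21330,1),\ (21130,6,21300,1),\ (21103,5,21310,1),\ (21310,1,21033,5),\ (21310,0,21030,5),\ (21300,1,21033,5),\ (21300,0,21030,5),\ (21030,1,21103,1),\ (21033,1,21113,1),\ (21330,0,21130,1),\ (21330,0,21130,5),\ (21130,6,23300,0),\ (21030,6,23100,0),\ (23100,0,20330,6),\ (20330,0,21130,0),\ (23300,0,21330,6)$. For $0\le i\le 3$, let $\omega_i$ be the 2-dimensional morphism that sends the index of a tile of $\mathcal T_{i+1}$ to a column of width one of indices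 of tiles of $\mathcal T_i$, written $[\text{bottom},\dots,\text{top}]$, as follows: $\omega_0$: $0\mapsto[2],\ 1\mapsto[3],\ 2\mapsto[4],\ 3\mapsto[5],\ 4\mapsto[6],\ 5\mapsto[7],\ 6\mapsto[8],\ 7\mapsto[10],\ 8\mapsto[0,9],\ 9\mapsto[1,3],\ 10\mapsto[1,7],\ 11\mapsto[1,8],\ 12\mapsto[1,10]$. $\omega_1$: $0\mapsto[0],\ 1\mapsto[1],\ 2\mapsto[2],\ 3\mapsto[3],\ 4\mapsto[4],\ 5\mapsto[5],\ 6\mapsto[6],\ 7\mapsto[7],\ 8\mapsto[8,1],\ 9\mapsto[8,5],\ 10\mapsto[8,6],\ 11\mapsto[8,7],\ 12\mapsto[9,1],\ 13\mapsto[9,5],\ 14\mapsto[9,6],\ 15\mapsto[10,0],\ 16\mapsto[10,3],\ 17\mapsto[11,5],\ 18\mapsto[11,7],\ 19\mapsto[12,2]$. $\omega_2$: $0\mapsto[2],\ 1\mapsto[3],\ 2\mapsto[4],\ 3\mapsto[5],\ 4\mapsto[8,1],\ 5\mapsto[8,5],\ 6\mapsto[8,6],\ 7\mapsto[9,0],\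 8\mapsto[9,3],\ 9\mapsto[10,5],\ 10\mapsto[10,7],\ 11\mapsto[11,2],\ 12\mapsto[12,5],\ 13\mapsto[12,6],\ 14\mapsto[13,4],\ 15\mapsto[14,5],\ 16\mapsto[15,3],\ 17\mapsto[16,3],\ 18\mapsto[16,4],\ 19\mapsto[17,3],\ 20\mapsto[18,2],\ 21\mapsto[19,0],\ 22\mapsto[19,3],\ 23\mapsto[19,4]$. $\omega_3$: $0\mapsto[5],\ 1\mapsto[8],\ 2\mapsto[11],\ 3\mapsto[12],\ 4\mapsto[14],\ 5\mapsto[15],\ 6\mapsto[16],\ 7\mapsto[17],\ 8\mapsto[18],\ 9\mapsto[19],\ 10\mapsto[20],\ 11\mapsto[22],\ 12\mapsto[23],\ 13\mapsto[4,3],\ 14\mapsto[5,2],\ 15\mapsto[6,3],\ 16\mapsto[7,1],\ 17\mapsto[7,2],\ 18\mapsto[8,1],\ 19\mapsto[8,2],\ 20\mapsto[9,1],\ 21\mapsto[10,0],\ 22\mapsto[11,2],\ 23\mapsto[12,2],\ 24\mapsto[15,2],\ 25\mapsto[16,2],\ 26\mapsto[20,2],\ 27\mapsto[22,2]$. For $x\in\Omega_{i+1}$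 the columns $\omega_i(x_{\mathbf m})$ in one row of $x$ all have the same height, so replacing every $x_{\mathbf m}$ by $\omega_i(x_{\mathbf m})$ gives a configuration $\omega_i(x)\in\{0,\dots,|\mathcal T_i|-1\}^{\mathbb Z^2}$, whose origin is placed at the lowest letter of $\omega_i(x_{\mathbf 0})$. Let $\jmath$ be the letter-to-letter map from the indices of $\mathcal T_5$ to those of $\mathcal T_4$ given by $\jmath(k)=k$ for $0\le k\le 22$ and $\jmath(k)=k-1$ for $23\le k\le 28$ (it replaces the top and bottom colours $6$ by $0$ and $5$ by $1$), applied to configurations letter by letter. Define \[X_4=\jmath(\Omega_5),\qquad X_i=\overline{\omega_i(X_{i+1})}^{\sigma}\quad\text{for } i=3,2,1,0.\] Corollary. For every $i$ with $0\le i\le 4$, $X_i\subseteq\Omega_i$ and $X_i$ is an aperiodic and minimal subshift. -/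

import Mathlib

namespace JeandelRao

/-! ### Subshifts of `A^(ℤ²)` -/

section Subshift

variable {A : Type*}

/-- The shift action `(σ^k x)_m = x_(m + k)` of `ℤ²` on `A^(ℤ²)`. -/
def shift (k : ℤ × ℤ) (x : ℤ × ℤ → A) : ℤ × ℤ → A := fun m => x (m + k)

/-- The closure of `X` under the shift, `⋃_k σ^k X`. -/
def shiftClosure (X : Set (ℤ × ℤ → A)) : Set (ℤ × ℤ → A) := ⋃ k : ℤ × ℤ, shift k '' X

/-- A subshift: a closed (product topology of the topology of `A`, which is discrete in all
uses), shift-invariant subset of `A^(ℤ²)`. -/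
def IsSubshift [TopologicalSpace A] (X : Set (ℤ × ℤ → A)) : Prop :=
  IsClosed X ∧ ∀ k : ℤ × ℤ, shift k '' X = X

/-- `X` contains no nonempty, proper, closed, shift-invariant subset. -/
def IsMinimal [TopologicalSpace A] (X : Set (ℤ × ℤ → A)) : Prop :=
  ∀ Z : Set (ℤ × ℤ → A), Z ⊆ X → Z.Nonempty → IsSubshift Z → Z = X

/-- `X` is nonempty and no element of `X` has a nonzero period. -/
def IsAperiodic (X : Set (ℤ × ℤ → A)) : Prop :=
  X.Nonempty ∧ ∀ x ∈ X, ∀ k : ℤ × ℤ, shift k x = x → k = 0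

/-- `X ⊆ Ω` is an aperiodic and minimal subshift of `Ω`. -/
def IsAperiodicMinimalSubshiftOf [TopologicalSpace A] (X Ω : Set (ℤ × ℤ → A)) : Prop :=
  X ⊆ Ω ∧ IsSubshift X ∧ IsMinimal X ∧ IsAperiodic X

end Subshift

/-! ### Wang tiles -/

/-- A Wang tile, given by the colours of its four edges. -/
structure WangTile where
  right : ℕ
  top : ℕ
  left : ℕ
  bottom : ℕ

/-- The Wang shift of the tiles `T 0, …, T (n - 1)`: the valid tilings of `ℤ²`, written as maps
to the indices of the tiles. -/
def wangShift {n : ℕ} (T : Fin n → WangTile) : Set (ℤ × ℤ → Fin n) :=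
  {x | ∀ m n : ℤ, (T (x (m, n))).right = (T (x (m + 1, n))).left ∧
    (T (x (m, n))).top = (T (x (m, n + 1))).bottom}

/-! ### Two-dimensional words and morphisms -/

/-- A two-dimensional word of shape `(width, height)`, in Cartesian coordinates. -/
structure Word (B : Type*) where
  width : ℕ
  height : ℕ
  letter : Fin width → Fin height → B

/-- A word of width one, given by its letters from bottom to top. -/
def Word.column {B : Type*} (l : List B) : Word B := ⟨1, l.length, fun _ j => l.get j⟩

section Morphism

variable {A B : Type*}

/-- `y = ω(x)`, where the two-dimensional morphism given on letters by `ω` is extended to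
configurations: `ℤ²` is cut by the vertical lines `a m` and the horizontal lines `b n` into a
grid whose `(m, n)` cell is filled by the word `ω(x_(m, n))`, and the origin is at the zero position
of the word `ω(x_0)`. -/
def IsImage (ω : A → Word B) (x : ℤ × ℤ → A) (y : ℤ × ℤ → B) : Prop :=
  ∃ a b : ℤ → ℤ, a 0 = 0 ∧ b 0 = 0 ∧ ∀ m n : ℤ,
    a (m + 1) = a m + (ω (x (m, n))).width ∧
    b (n + 1) = b n + (ω (x (m, n))).height ∧
    ∀ (i : Fin (ω (x (m, n))).width) (j : Fin (ω (x (m, n))).height),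
      y (a m + (i : ℕ), b n + (j : ℕ)) = (ω (x (m, n))).letter i j

/-- The set `ω(X)`. -/
def morphismImage (ω : A → Word B) (X : Set (ℤ × ℤ → A)) : Set (ℤ × ℤ → B) :=
  {y | ∃ x ∈ X, IsImage ω x y}

/-- Lengths `w m` cut `ℤ` into consecutive intervals. -/
theorem exists_cuts (w : ℤ → ℕ) :
    ∃ a : ℤ → ℤ, a 0 = 0 ∧ (∀ m, a (m + 1) = a m + w m) := by
  refine ⟨fun m => ∑ i ∈ Finset.Ico 0 m, (w i : ℤ) - ∑ i ∈ Finset.Ico m 0, (w i : ℤ),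
    by simp, fun m => ?_⟩
  rcases le_or_gt 0 m with h | h
  · have e : Finset.Ico 0 (m + 1) = insert m (Finset.Ico 0 m) := by
      ext i; simp only [Finset.mem_Ico, Finset.mem_insert]; omega
    have e1 : Finset.Ico (m + 1) 0 = ∅ :=
      Finset.Ico_eq_empty (by omega)
    have e2 : Finset.Ico m 0 = ∅ :=
      Finset.Ico_eq_empty (by omega)
    simp only [e, e1, e2]
    rw [Finset.sum_insert (by simp)]
    simp; ring
  · have e : Finset.Ico m 0 = insert m (Finset.Ico (m + 1) 0) := by
      ext i; simp only [Finset.mem_Ico, Finset.mem_insert]; omega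
    have e1 : Finset.Ico 0 (m + 1) = ∅ :=
      Finset.Ico_eq_empty (by omega)
    have e2 : Finset.Ico 0 m = ∅ :=
      Finset.Ico_eq_empty (by omega)
    simp only [e, e1, e2]
    rw [Finset.sum_insert (by simp)]
    simp

/-- If the lengths are positive, every integer lies in exactly one of the intervals. -/
theorem existsUnique_cell (w : ℤ → ℕ) (hw : ∀ m, 0 < w m) (a : ℤ → ℤ) (h0 : a 0 = 0)
    (ha : ∀ m, a (m + 1) = a m + w m) (p : ℤ) :
    ∃! m : ℤ, a m ≤ p ∧ p < a (m + 1) := by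
  have hs : StrictMono a := by
    refine strictMono_int_of_lt_succ fun m => ?_
    have := ha m
    have := hw m
    omega
  have hg : ∀ m : ℤ, m ≤ 0 → a m ≤ m := by
    intro m hm
    induction m, hm using Int.leInductionDown with
    | base => simp [h0]
    | pred n _ ih =>
      have h1 := ha (n - 1)
      have h2 := hw (n - 1)
      rw [sub_add_cancel] at h1
      omega
  have hg' : ∀ m : ℤ, 0 ≤ m → m ≤ a m := by
    intro m hm
    induction m, hm using Int.leInduction with
    | base => simp [h0]
    | succ n _ ih =>
      have h1 := ha n
      have h2 := hw n
      omega
  obtain ⟨m, hm, hmax⟩ := Int.exists_greatest_of_bdd (P := fun m => a m ≤ p)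
    ⟨max p 0, fun z hz => by
      by_contra hc
      have := hg' z (by omega)
      omega⟩
    ⟨min p 0, (hg _ (min_le_right _ _)).trans (min_le_left _ _)⟩
  refine ⟨m, ⟨hm, ?_⟩, ?_⟩
  · by_contra hc
    have := hmax (m + 1) (by omega)
    omega
  · rintro k ⟨hk1, hk2⟩
    have h1 := hmax k hk1
    have h2 : m < k + 1 := hs.lt_iff_lt.1 (lt_of_le_of_lt hm hk2)
    omega

/-- If the images of adjacent letters of `x` fit together, then `ω(x)` is well defined. -/
theorem existsUnique_isImage (ω : A → Word B) (x : ℤ × ℤ → A)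
    (hw0 : ∀ m n, 0 < (ω (x (m, n))).width) (hh0 : ∀ m n, 0 < (ω (x (m, n))).height)
    (hw : ∀ m n, (ω (x (m, n))).width = (ω (x (m, n + 1))).width)
    (hh : ∀ m n, (ω (x (m, n))).height = (ω (x (m + 1, n))).height) :
    ∃! y, IsImage ω x y := by
  have hw' : ∀ m n, (ω (x (m, n))).width = (ω (x (m, 0))).width := by
    intro m n
    induction n using Int.induction_on with
    | zero => rfl
    | succ n ih => rw [← hw, ih]
    | pred n ih => rw [hw, sub_add_cancel, ih]
  have hh' : ∀ m n, (ω (x (m, n))).height = (ω (x (0, n))).height := by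
    intro m n
    induction m using Int.induction_on with
    | zero => rfl
    | succ m ih => rw [← hh, ih]
    | pred m ih => rw [hh, sub_add_cancel, ih]
  obtain ⟨a, a0, ha⟩ := exists_cuts (fun m => (ω (x (m, 0))).width)
  obtain ⟨b, b0, hb⟩ := exists_cuts (fun n => (ω (x (0, n))).height)
  have ca := existsUnique_cell _ (fun m => hw0 m 0) a a0 ha
  have cb := existsUnique_cell _ (fun n => hh0 0 n) b b0 hb
  choose u hu hu' using ca
  choose v hv hv' using cb
  have ex : ∀ p q : ℤ, ∃ (i : Fin (ω (x (u p, v q))).width) (j : Fin (ω (x (u p, v q))).height),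
      p = a (u p) + (i : ℕ) ∧ q = b (v q) + (j : ℕ) := by
    intro p q
    have h1 := hu p
    have h2 := hv q
    simp only [ha, hb] at h1 h2
    refine ⟨⟨(p - a (u p)).toNat, ?_⟩, ⟨(q - b (v q)).toNat, ?_⟩, ?_, ?_⟩
    · rw [hw']; omega
    · rw [hh']; omega
    · simp only []; omega
    · simp only []; omega
  choose i j hi hj using ex
  refine ⟨fun p => (ω (x (u p.1, v p.2))).letter (i p.1 p.2) (j p.1 p.2),
    ⟨a, b, a0, b0, fun m n => ⟨?_, ?_, ?_⟩⟩, ?_⟩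
  · rw [ha, hw' m n]
  · rw [hb, hh' m n]
  · intro i' j'
    have hp : u (a m + (i' : ℕ)) = m := by
      refine (hu' _ m ⟨by omega, ?_⟩).symm
      rw [ha, ← hw' m n]; omega
    have hq : v (b n + (j' : ℕ)) = n := by
      refine (hv' _ n ⟨by omega, ?_⟩).symm
      rw [hb, ← hh' m n]; omega
    have h1 := hi (a m + (i' : ℕ)) (b n + (j' : ℕ))
    have h2 := hj (a m + (i' : ℕ)) (b n + (j' : ℕ))
    simp only []
    generalize i (a m + (i' : ℕ)) (b n + (j' : ℕ)) = i1 at *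
    generalize j (a m + (i' : ℕ)) (b n + (j' : ℕ)) = j1 at *
    generalize u (a m + (i' : ℕ)) = u1 at *
    generalize v (b n + (j' : ℕ)) = v1 at *
    subst hp hq
    congr 1 <;> apply Fin.ext <;> omega
  · rintro z ⟨a', b', a0', b0', hz⟩
    have ea : a' = a := by
      funext m
      induction m using Int.induction_on with
      | zero => rw [a0, a0']
      | succ m ih => rw [(hz m 0).1, ha, ih]
      | pred m ih =>
        have h1 := (hz (-m - 1) 0).1
        have h2 := ha (-m - 1)
        rw [sub_add_cancel] at h1 h2
        omega
    have eb : b' = b := by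
      funext n
      induction n using Int.induction_on with
      | zero => rw [b0, b0']
      | succ n ih => rw [(hz 0 n).2.1, hb, ih]
      | pred n ih =>
        have h1 := (hz 0 (-n - 1)).2.1
        have h2 := hb (-n - 1)
        rw [sub_add_cancel] at h1 h2
        omega
    subst ea eb
    funext ⟨p, q⟩
    have h := (hz (u p) (v q)).2.2 (i p q) (j p q)
    rw [← hi p q, ← hj p q] at h
    exact h

/-- A morphism with columns as images is well defined on a Wang shift if, along any matching
vertical edge, the images have equal positive height. -/
theorem existsUnique_isImage_column {n k : ℕ} (T : Fin n → WangTile) (l : Fin n → List (Fin k))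
    (h0 : ∀ s, 0 < (l s).length)
    (h : ∀ s t, (T s).right = (T t).left → (l s).length = (l t).length)
    (x : ℤ × ℤ → Fin n) (hx : x ∈ wangShift T) :
    ∃! y, IsImage (fun s => Word.column (l s)) x y :=
  existsUnique_isImage _ x (fun _ _ => Nat.one_pos) (fun _ _ => h0 _) (fun _ _ => rfl)
    (fun m n => h _ _ (hx m n).1)

end Morphism

/-! ### The sets of tiles, listed as (right, top, left, bottom) -/

/-- The Jeandel-Rao set `𝒯₀` of 11 Wang tiles. -/
def tiles0 : Fin 11 → WangTile :=
  ![⟨2, 4, 2, 1⟩, ⟨2, 2, 2, 0⟩, ⟨1, 1, 3, 1⟩, ⟨1, 2, 3, 2⟩, ⟨3, 1, 3, 3⟩, ⟨0, 1, 3, 1⟩,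
  ⟨0, 0, 0, 1⟩, ⟨3, 1, 0, 2⟩, ⟨0, 2, 1, 2⟩, ⟨1, 2, 1, 4⟩, ⟨3, 3, 1, 2⟩]

/-- The set `𝒯₁` of 13 Wang tiles. -/
def tiles1 : Fin 13 → WangTile :=
  ![⟨1, 1, 3, 1⟩, ⟨1, 2, 3, 2⟩, ⟨3, 1, 3, 3⟩, ⟨0, 1, 3, 1⟩, ⟨0, 0, 0, 1⟩, ⟨3, 1, 0, 2⟩,
  ⟨0, 2, 1, 2⟩, ⟨3, 3, 1, 2⟩, ⟨21, 2, 21, 1⟩, ⟨21, 2, 23, 0⟩, ⟨23, 1, 20, 0⟩,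
  ⟨20, 2, 21, 0⟩, ⟨23, 3, 21, 0⟩]

/-- The set `𝒯₂` of 20 Wang tiles. -/
def tiles2 : Fin 20 → WangTile :=
  ![⟨1, 1, 3, 1⟩, ⟨1, 2, 3, 2⟩, ⟨3, 1, 3, 3⟩, ⟨0, 1, 3, 1⟩, ⟨0, 0, 0, 1⟩, ⟨3, 1, 0, 2⟩,
  ⟨0, 2, 1, 2⟩, ⟨3, 3, 1, 2⟩, ⟨211, 2, 213, 1⟩, ⟨213, 1, 210, 1⟩, ⟨210, 2, 211, 1⟩,
  ⟨213, 3, 211, 1⟩, ⟨211, 2, 233, 0⟩, ⟨213, 1, 230, 0⟩, ⟨210, 2, 231, 0⟩, ⟨231, 1, 203, 0⟩,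
  ⟨230, 1, 203, 0⟩, ⟨203, 1, 210, 0⟩, ⟨203, 3, 211, 0⟩, ⟨233, 1, 213, 0⟩]

/-- The set `𝒯₃` of 24 Wang tiles. -/
def tiles3 : Fin 24 → WangTile :=
  ![⟨3, 1, 3, 3⟩, ⟨0, 1, 3, 1⟩, ⟨0, 0, 0, 1⟩, ⟨3, 1, 0, 2⟩, ⟨2111, 2, 2133, 1⟩,
  ⟨2113, 1, 2130, 1⟩, ⟨2110, 2, 2131, 1⟩, ⟨2131, 1, 2103, 1⟩, ⟨2130, 1, 2103, 1⟩,
  ⟨2103, 1, 2110, 1⟩, ⟨2103, 3, 2111, 1⟩, ⟨2133, 1, 2113, 1⟩, ⟨2113, 1, 2330, 0⟩,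
  ⟨2110, 2, 2331, 0⟩, ⟨2130, 0, 2300, 0⟩, ⟨2103, 1, 2310, 0⟩, ⟨2310, 1, 2033, 0⟩,
  ⟨2300, 1, 2033, 0⟩, ⟨2300, 0, 2030, 0⟩, ⟨2030, 1, 2103, 0⟩, ⟨2033, 1, 2113, 0⟩,
  ⟨2331, 1, 2133, 0⟩, ⟨2330, 1, 2133, 0⟩, ⟨2330, 0, 2130, 0⟩]

/-- The set `𝒯₄` of 28 Wang tiles. -/
def tiles4 : Fin 28 → WangTile :=
  ![⟨2113, 1, 2130, 1⟩, ⟨2130, 1, 2103, 1⟩, ⟨2133, 1, 2113, 1⟩, ⟨2113, 1, 2330, 0⟩,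
  ⟨2130, 0, 2300, 0⟩, ⟨2103, 1, 2310, 0⟩, ⟨2310, 1, 2033, 0⟩, ⟨2300, 1, 2033, 0⟩,
  ⟨2300, 0, 2030, 0⟩, ⟨2030, 1, 2103, 0⟩, ⟨2033, 1, 2113, 0⟩, ⟨2330, 1, 2133, 0⟩,
  ⟨2330, 0, 2130, 0⟩, ⟨21113, 1, 21330, 1⟩, ⟨21130, 0, 21300, 1⟩, ⟨21103, 1, 21310, 1⟩,
  ⟨21310, 1, 21033, 1⟩, ⟨21310, 0, 21030, 1⟩, ⟨21300, 1, 21033, 1⟩, ⟨21300, 0, 21030, 1⟩,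
  ⟨21030, 1, 21103, 1⟩, ⟨21033, 1, 21113, 1⟩, ⟨21330, 0, 21130, 1⟩, ⟨21130, 0, 23300, 0⟩,
  ⟨21030, 0, 23100, 0⟩, ⟨23100, 0, 20330, 0⟩, ⟨20330, 0, 21130, 0⟩, ⟨23300, 0, 21330, 0⟩]

/-- The set `𝒯₅` of 29 Wang tiles: tiles of `𝒯₄` with decorated horizontal colours, where some
0 are replaced by 6 and some 1 are replaced by 5. -/
def tiles5 : Fin 29 → WangTile :=
  ![⟨2113, 5, 2130, 1⟩, ⟨2130, 1, 2103, 5⟩, ⟨2133, 1, 2113, 1⟩, ⟨2113, 5, 2330, 0⟩,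
  ⟨2130, 6, 2300, 0⟩, ⟨2103, 5, 2310, 0⟩, ⟨2310, 1, 2033, 6⟩, ⟨2300, 1, 2033, 6⟩,
  ⟨2300, 0, 2030, 6⟩, ⟨2030, 1, 2103, 0⟩, ⟨2033, 1, 2113, 0⟩, ⟨2330, 1, 2133, 6⟩,
  ⟨2330, 0, 2130, 6⟩, ⟨21113, 5, 21330, 1⟩, ⟨21130, 6, 21300, 1⟩, ⟨21103, 5, 21310, 1⟩,
  ⟨21310, 1, 21033, 5⟩, ⟨21310, 0, 21030, 5⟩, ⟨21300, 1, 21033, 5⟩, ⟨21300, 0, 21030, 5⟩,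
  ⟨21030, 1, 21103, 1⟩, ⟨21033, 1, 21113, 1⟩, ⟨21330, 0, 21130, 1⟩, ⟨21330, 0, 21130, 5⟩,
  ⟨21130, 6, 23300, 0⟩, ⟨21030, 6, 23100, 0⟩, ⟨23100, 0, 20330, 6⟩, ⟨20330, 0, 21130, 0⟩,
  ⟨23300, 0, 21330, 6⟩]

/-! ### The morphisms -/

/-- The morphism `ω_0 : Ω_1 → Ω_0`; each column is listed from bottom to top. -/
def omega0 (k : Fin 13) : Word (Fin 11) := Word.column <|
  (![[2], [3], [4], [5], [6], [7], [8], [10], [0, 9], [1, 3], [1, 7], [1, 8], [1, 10]] : Fin 13 → List (Fin 11)) k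

/-- The morphism `ω_1 : Ω_2 → Ω_1`; each column is listed from bottom to top. -/
def omega1 (k : Fin 20) : Word (Fin 13) := Word.column <|
  (![[0], [1], [2], [3], [4], [5], [6], [7], [8, 1], [8, 5], [8, 6], [8, 7], [9, 1],
  [9, 5], [9, 6], [10, 0], [10, 3], [11, 5], [11, 7], [12, 2]] : Fin 20 → List (Fin 13)) k

/-- The morphism `ω_2 : Ω_3 → Ω_2`; each column is listed from bottom to top. -/
def omega2 (k : Fin 24) : Word (Fin 20) := Word.column <|
  (![[2], [3], [4], [5], [8, 1], [8, 5], [8, 6], [9, 0], [9, 3], [10, 5], [10, 7], [11, 2],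
  [12, 5], [12, 6], [13, 4], [14, 5], [15, 3], [16, 3], [16, 4], [17, 3], [18, 2], [19, 0],
  [19, 3], [19, 4]] : Fin 24 → List (Fin 20)) k

/-- The morphism `ω_3 : Ω_4 → Ω_3`; each column is listed from bottom to top. -/
def omega3 (k : Fin 28) : Word (Fin 24) := Word.column <|
  (![[5], [8], [11], [12], [14], [15], [16], [17], [18], [19], [20], [22], [23], [4, 3],
  [5, 2], [6, 3], [7, 1], [7, 2], [8, 1], [8, 2], [9, 1], [10, 0], [11, 2], [12, 2],
  [15, 2], [16, 2], [20, 2], [22, 2]] : Fin 28 → List (Fin 24)) k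

/-- The map `ȷ : 𝒯₅ → 𝒯₄`, which removes the decorations. -/
def jmath : Fin 29 → Fin 28 :=
  ![0, 1, 2, 3, 4, 5, 6, 7, 8, 9, 10, 11, 12, 13, 14, 15, 16, 17, 18, 19, 20, 21, 22, 22,
  23, 24, 25, 26, 27]

/-- The projection of horizontal colours `0, 6 ↦ 0` and `1, 5 ↦ 1`. -/
def jmathColour (c : ℕ) : ℕ := if c = 0 ∨ c = 6 then 0 else 1

/-- `ȷ` applies the projection of colours to the top and bottom edges. -/
theorem tiles4_jmath (k : Fin 29) : tiles4 (jmath k) =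
    ⟨(tiles5 k).right, jmathColour (tiles5 k).top, (tiles5 k).left,
      jmathColour (tiles5 k).bottom⟩ := by
  fin_cases k <;> rfl

/-! ### The Wang shifts `Ω₀, …, Ω₅` and the subsets `X₀, …, X₄` -/

/-- `Ω₀`, the Jeandel-Rao Wang shift. -/
def Omega0 : Set (ℤ × ℤ → Fin 11) := wangShift tiles0
/-- `Ω₁`. -/
def Omega1 : Set (ℤ × ℤ → Fin 13) := wangShift tiles1
/-- `Ω₂`. -/
def Omega2 : Set (ℤ × ℤ → Fin 20) := wangShift tiles2
/-- `Ω₃`. -/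
def Omega3 : Set (ℤ × ℤ → Fin 24) := wangShift tiles3
/-- `Ω₄`. -/
def Omega4 : Set (ℤ × ℤ → Fin 28) := wangShift tiles4
/-- `Ω₅`. -/
def Omega5 : Set (ℤ × ℤ → Fin 29) := wangShift tiles5

/-- `ω₀(x)` is well defined for every `x ∈ Ω₁`. -/
theorem omega0_existsUnique (x : ℤ × ℤ → Fin 13) (hx : x ∈ Omega1) : ∃! y, IsImage omega0 x y :=
  existsUnique_isImage_column tiles1 _ (by decide) (by decide) x hx

/-- `ω₁(x)` is well defined for every `x ∈ Ω₂`. -/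
theorem omega1_existsUnique (x : ℤ × ℤ → Fin 20) (hx : x ∈ Omega2) : ∃! y, IsImage omega1 x y :=
  existsUnique_isImage_column tiles2 _ (by decide) (by decide) x hx

/-- `ω₂(x)` is well defined for every `x ∈ Ω₃`. -/
theorem omega2_existsUnique (x : ℤ × ℤ → Fin 24) (hx : x ∈ Omega3) : ∃! y, IsImage omega2 x y :=
  existsUnique_isImage_column tiles3 _ (by decide) (by decide) x hx

/-- `ω₃(x)` is well defined for every `x ∈ Ω₄`. -/
theorem omega3_existsUnique (x : ℤ × ℤ → Fin 28) (hx : x ∈ Omega4) : ∃! y, IsImage omega3 x y :=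
  existsUnique_isImage_column tiles4 _ (by decide) (by decide) x hx

/-- `X₄ = ȷ(Ω₅)`, where `ȷ` acts tile by tile. -/
def X4 : Set (ℤ × ℤ → Fin 28) := (fun x p => jmath (x p)) '' Omega5
/-- `X₃`, the closure of `ω₃(X₄)` under the shift. -/
def X3 : Set (ℤ × ℤ → Fin 24) := shiftClosure (morphismImage omega3 X4)
/-- `X₂`, the closure of `ω₂(X₃)` under the shift. -/
def X2 : Set (ℤ × ℤ → Fin 20) := shiftClosure (morphismImage omega2 X3)
/-- `X₁`, the closure of `ω₁(X₂)` under the shift. -/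
def X1 : Set (ℤ × ℤ → Fin 13) := shiftClosure (morphismImage omega1 X2)
/-- `X₀`, the closure of `ω₀(X₁)` under the shift. -/
def X0 : Set (ℤ × ℤ → Fin 11) := shiftClosure (morphismImage omega0 X1)

end JeandelRao

/-! All five subshifts get minimality and aperiodicity from one self-similar system hidden inside
$\Omega_5$. Shearing a tiling by $\mathcal T_5$ to $x(m+n,n)$ turns it into a configuration
described by finitely many allowed dominoes (`dominoes6`). There, certain marker letters fill whole
lines, no two of them adjacent. Gluing each marker line to the neighbouring line on a fixed side
reads the tiling as the image of a tiling over a new alphabet, whose domino constraints can be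
computed. Three such desubstitutions lead to `dominoes9`, and four more, alternating between the two
directions, lead from `dominoes9` back to `dominoes9`. So every tiling by `dominoes9` is the image
of another one under a fixed substitution `inflation`, whose blocks have both sides at least two.

Aperiodicity: marker lines are visible in the tiling, so every period lifts to the desubstituted
tiling (`Recognizes`). The lift has at most half the size, and infinite descent applies
(`noPeriod_of_selfSimilar`).

Minimality: it is enough that every square of letters of one tiling occurs in every other tiling.
Expansion by two reduces this to squares of side two (`SquaresRecur.of_selfSimilar`), and these are
settled by a finite computation: one seed square occurs in every tiling, and its threefold image
contains all squares that can occur (`squaresRecur9`).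

Nonemptiness: inflating repeatedly gives arbitrarily large valid patches, and compactness gives a
tiling (`exists_large_patch`, `wangShift_nonempty`).

These properties, bundled in `IsRepetitive`, go back through the shear to $\Omega_5$, through
$\jmath$ to $X_4$, and through each $\omega_i$ to $X_i$ (`IsRepetitive.shiftClosure_morphismImage`).
The last passage needs only that $\omega_i$ respects adjacency and is recognizable by markers; it
need not be onto $\Omega_i$ up to shifts. The subshifts $X_i$ are closed because columns have height
at most two, which leaves finitely many positions for the origin (`isClosed_stackImage`). -/

namespace JeandelRao

/-! ### Substitutions by rectangular blocks -/

section Blocks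

variable {A B C : Type*}

/-- A substitution by rectangular blocks: the letter `c` is replaced by the block of size
`width c × height c` with entries `letter c i j`. -/
structure Blocks (A B : Type*) where
  width : B → ℕ
  height : B → ℕ
  letter : B → ℕ → ℕ → A

namespace Blocks

/-- The trivial substitution. -/
def unit (A : Type*) : Blocks A A := ⟨fun _ => 1, fun _ => 1, fun c _ _ => c⟩

/-- Exchange of the two coordinates. -/
def transpose (F : Blocks A B) : Blocks A B := ⟨F.height, F.width, fun c i j => F.letter c j i⟩

/-- The composition of `F` with a substitution `s` by columns of height one or two. -/
def vstack (F : Blocks A B) (s : C → B × Option B) : Blocks A C where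
  width c := F.width (s c).1
  height c := F.height (s c).1 + (s c).2.elim 0 F.height
  letter c i j := if j < F.height (s c).1 then F.letter (s c).1 i j
    else F.letter ((s c).2.getD (s c).1) i (j - F.height (s c).1)

/-- The composition of `F` with a substitution `s` by rows of width one or two. -/
def hstack (F : Blocks A B) (s : C → B × Option B) : Blocks A C := (F.transpose.vstack s).transpose

/-- `x` is obtained from `y` by replacing each letter by its block, along the vertical lines `a`
and the horizontal lines `b`. -/
structure Image (F : Blocks A B) (y : ℤ → ℤ → B) (x : ℤ → ℤ → A) (a b : ℤ → ℤ) : Prop where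
  width : ∀ m n, a (m + 1) = a m + F.width (y m n)
  height : ∀ m n, b (n + 1) = b n + F.height (y m n)
  letter : ∀ m n (i j : ℕ), i < F.width (y m n) → j < F.height (y m n) →
    x (a m + i) (b n + j) = F.letter (y m n) i j

theorem Image.transpose {F : Blocks A B} {y : ℤ → ℤ → B} {x : ℤ → ℤ → A} {a b : ℤ → ℤ}
    (h : F.Image y x a b) : F.transpose.Image (fun m n => y n m) (fun m n => x n m) b a :=
  ⟨fun m n => h.height n m, fun m n => h.width n m, fun m n i j hi hj => h.letter n m j i hj hi⟩

theorem unit_image (x : ℤ → ℤ → A) : (unit A).Image x x id id := by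
  refine ⟨fun m n => by simp [unit], fun m n => by simp [unit], fun m n i j hi hj => ?_⟩
  simp only [unit, Nat.lt_one_iff] at hi hj ⊢
  simp [hi, hj]

end Blocks

/-- `y` is obtained from `z` by replacing each letter by a column of height one or two,
along the horizontal lines `b`. -/
structure IsStacking (s : C → B × Option B) (z : ℤ → ℤ → C) (y : ℤ → ℤ → B) (b : ℤ → ℤ) :
    Prop where
  height : ∀ m n, b (n + 1) = b n + if (s (z m n)).2.isSome then 2 else 1
  fst : ∀ m n, y m (b n) = (s (z m n)).1
  snd : ∀ m n v, (s (z m n)).2 = some v → y m (b n + 1) = v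

theorem Blocks.Image.vstack {F : Blocks A B} {s : C → B × Option B} {y : ℤ → ℤ → B}
    {x : ℤ → ℤ → A} {z : ℤ → ℤ → C} {a b b' : ℤ → ℤ} (h : F.Image y x a b)
    (hs : IsStacking s z y b') : (F.vstack s).Image z x a (b ∘ b') := by
  refine ⟨fun m n => ?_, fun m n => ?_, fun m n i j hi hj => ?_⟩
  · rw [h.width m (b' n), hs.fst]; rfl
  · have h1 := h.height m (b' n)
    have h2 := h.height m (b' n + 1)
    have h3 := hs.height m n
    rw [hs.fst] at h1
    simp only [Function.comp, Blocks.vstack]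
    cases e : (s (z m n)).2 with
    | none => rw [e] at h3; simp at h3; simp [h3, h1]
    | some v =>
      rw [e] at h3; simp at h3
      rw [hs.snd m n v e, add_assoc, one_add_one_eq_two] at h2
      simp [h3, h2, h1, add_assoc]
  · simp only [Function.comp, Blocks.vstack] at hi hj ⊢
    have h1 := h.letter m (b' n)
    rw [hs.fst] at h1
    split_ifs with hlt
    · exact h1 i j hi hlt
    · cases e : (s (z m n)).2 with
      | none => rw [e] at hj; exact absurd hj (by simpa using hlt)
      | some v =>
        rw [e] at hj
        have h2 := h.letter m (b' n + 1) i (j - F.height (s (z m n)).1)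
        have h3 := h.height m (b' n)
        have h4 := h.width m (b' n)
        have h5 := h.width m (b' n + 1)
        rw [hs.snd m n v e] at h2 h5
        rw [hs.fst] at h3 h4
        simp only [Option.elim_some, Option.getD_some, not_lt] at hj hlt ⊢
        rw [← h2 (by omega) (by omega), h3]
        congr 1
        push_cast [hlt]
        ring

theorem Blocks.Image.hstack {F : Blocks A B} {s : C → B × Option B} {y : ℤ → ℤ → B}
    {x : ℤ → ℤ → A} {z : ℤ → ℤ → C} {a b a' : ℤ → ℤ} (h : F.Image y x a b)
    (hs : IsStacking s (fun m n => z n m) (fun m n => y n m) a') :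
    (F.hstack s).Image z x (a ∘ a') b :=
  (h.transpose.vstack hs).transpose

/-! ### Recognizability -/

/-- Every period of `x` comes from a period of `y`. -/
def Recognizes (y : ℤ → ℤ → B) (x : ℤ → ℤ → A) (a b : ℤ → ℤ) : Prop :=
  ∀ k l, (∀ m n, x (m + k) (n + l) = x m n) → ∃ k' l', (∀ m n, y (m + k') (n + l') = y m n) ∧
    (∀ m, a (m + k') = a m + k) ∧ ∀ n, b (n + l') = b n + l

theorem Recognizes.refl (x : ℤ → ℤ → A) : Recognizes x x id id :=
  fun k l h => ⟨k, l, h, fun _ => rfl, fun _ => rfl⟩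

theorem Recognizes.trans {z : ℤ → ℤ → C} {y : ℤ → ℤ → B} {x : ℤ → ℤ → A} {a b a' b' : ℤ → ℤ}
    (h : Recognizes y x a b) (h' : Recognizes z y a' b') :
    Recognizes z x (a ∘ a') (b ∘ b') := by
  intro k l hx
  obtain ⟨k1, l1, hy, ha, hb⟩ := h k l hx
  obtain ⟨k2, l2, hz, ha', hb'⟩ := h' k1 l1 hy
  exact ⟨k2, l2, hz, fun m => by simp [ha', ha], fun n => by simp [hb', hb]⟩

theorem Recognizes.transpose {y : ℤ → ℤ → B} {x : ℤ → ℤ → A} {a b : ℤ → ℤ}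
    (h : Recognizes y x a b) : Recognizes (fun m n => y n m) (fun m n => x n m) b a := by
  intro k l hx
  obtain ⟨k', l', hy, ha, hb⟩ := h l k fun m n => hx n m
  exact ⟨l', k', fun m n => hy n m, hb, ha⟩

/-- The rows of `u` and of `v` above it belong to the same column, if the markers `M` are the
upper (`top = true`) or the lower letters of the columns of height two. -/
def Joined (top : Bool) (M : B → Prop) (u v : B) : Prop := if top then M v else M u

instance (top : Bool) (M : B → Prop) [DecidablePred M] (u v : B) :
    Decidable (Joined top M u v) := by
  unfold Joined; infer_instance

/-- The markers `M` are exactly the upper (`top = true`) or the lower letters of the column `e` if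
it has height two, and do not occur in it if it has height one. -/
def Marked (top : Bool) (M : B → Prop) (e : B × Option B) : Prop :=
  match e.2 with
  | none => ¬ M e.1
  | some v => if top then ¬ M e.1 ∧ M v else M e.1 ∧ ¬ M v

instance (top : Bool) (M : B → Prop) [DecidablePred M] (e : B × Option B) :
    Decidable (Marked top M e) := by
  unfold Marked; split <;> infer_instance

theorem IsStacking.strictMono {s : C → B × Option B} {z : ℤ → ℤ → C} {y : ℤ → ℤ → B} {b : ℤ → ℤ}
    (h : IsStacking s z y b) : StrictMono b := by
  refine strictMono_int_of_lt_succ fun n => ?_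
  have := h.height 0 n
  split_ifs at this <;> omega

/-- Every integer lies in one of the intervals cut out by the `a m`. -/
theorem exists_cell (a : ℤ → ℤ) (ha : ∀ m, a m < a (m + 1)) (p : ℤ) :
    ∃ m, a m ≤ p ∧ p < a (m + 1) := by
  obtain ⟨m, hm, -⟩ := existsUnique_cell (fun m => (a (m + 1) - a m).toNat)
    (fun m => by have := ha m; omega) (fun m => a m - a 0) (by simp)
    (fun m => by have := ha m; omega) (p - a 0)
  exact ⟨m, by omega, by omega⟩

/-- This makes the cuts a local feature of `y`: two vertically adjacent letters decide whether a cut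
runs between them. Recognizability rests on it, since a translation preserving `y` must then
preserve the set of cuts. -/
theorem IsStacking.mem_range_iff {s : C → B × Option B} {z : ℤ → ℤ → C} {y : ℤ → ℤ → B}
    {b : ℤ → ℤ} (h : IsStacking s z y b) {top : Bool} {M : B → Prop}
    (hM : ∀ m n, Marked top M (s (z m n))) (m q : ℤ) :
    q ∈ Set.range b ↔ ¬ Joined top M (y m (q - 1)) (y m q) := by
  obtain ⟨n, h1, h2⟩ := exists_cell b (fun n => h.strictMono (by omega)) q
  have h3 := h.height m n
  rcases eq_or_lt_of_le h1 with h1 | h1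
  · subst h1
    refine iff_of_true ⟨n, rfl⟩ ?_
    have h4 := h.height m (n - 1)
    have h5 := h.fst m (n - 1)
    have h6 := h.snd m (n - 1)
    have h7 := hM m (n - 1)
    have h8 := hM m n
    rw [sub_add_cancel] at h4
    rw [h.fst]
    unfold Joined Marked at *
    cases top
    · cases e : (s (z m (n - 1))).2 with
      | none =>
        simp only [e] at h4 h7
        simp at h4
        rw [h4, add_sub_cancel_right, h5]
        simpa using h7
      | some v =>
        simp only [e] at h4 h7
        simp at h4
        rw [h4, add_sub_assoc, show (2 : ℤ) - 1 = 1 by norm_num, h6 v e]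
        simpa using h7.2
    · cases e : (s (z m n)).2 <;> simp only [e] at h8 <;> simp at h8 ⊢ <;> tauto
  · have h4 := hM m n
    have h5 := h.snd m n
    cases e : (s (z m n)).2 with
    | none => simp [e] at h3; omega
    | some v =>
      simp [e] at h3
      obtain rfl : q = b n + 1 := by omega
      refine iff_of_false ?_ ?_
      · rintro ⟨t, ht⟩
        have h6 : n < t := h.strictMono.lt_iff_lt.1 (by omega)
        have h7 : t < n + 1 := h.strictMono.lt_iff_lt.1 (by omega)
        omega
      · rw [add_sub_cancel_right, h.fst, h5 v e, not_not]
        simp only [Marked, e] at h4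
        unfold Joined
        cases top <;> simp at h4 ⊢ <;> tauto

/-- A period of `y` permutes the cuts in increasing order, so it shifts their indices by a constant.
The columns between corresponding cuts then agree, and injectivity of `s` returns the letters of
`z`. -/
theorem IsStacking.recognizes {s : C → B × Option B} {z : ℤ → ℤ → C} {y : ℤ → ℤ → B}
    {b : ℤ → ℤ} (h : IsStacking s z y b) {top : Bool} {M : B → Prop}
    (hM : ∀ m n, Marked top M (s (z m n))) (L : Set C) (hz : ∀ m n, z m n ∈ L)
    (hs : Set.InjOn s L) : Recognizes z y id b := by
  intro k l hy
  have hr : ∀ q, q + l ∈ Set.range b ↔ q ∈ Set.range b := fun q => by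
    rw [h.mem_range_iff hM 0 q, h.mem_range_iff hM (0 + k) (q + l), ← hy 0 (q - 1), ← hy 0 q,
      sub_add_eq_add_sub]
  obtain ⟨l', hl'⟩ := (hr (b 0)).2 ⟨0, rfl⟩
  -- Translation by `l` maps the cuts onto themselves and preserves their order, so it sends
  -- neighbouring cuts to neighbouring cuts.
  have key : ∀ n n', b n' = b n + l → b (n' + 1) = b (n + 1) + l ∧ b (n' - 1) = b (n - 1) + l := by
    intro n n' e
    have hb := h.strictMono
    obtain ⟨t1, h1⟩ := (hr (b (n + 1))).2 ⟨_, rfl⟩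
    obtain ⟨t2, h2⟩ := (hr (b (n - 1))).2 ⟨_, rfl⟩
    obtain ⟨t3, h3⟩ := (hr (b (n' + 1) - l)).1 ⟨n' + 1, by ring⟩
    obtain ⟨t4, h4⟩ := (hr (b (n' - 1) - l)).1 ⟨n' - 1, by ring⟩
    have a1 : b n < b (n + 1) := hb (by omega)
    have a2 : b (n - 1) < b n := hb (by omega)
    have a3 : b n' < b (n' + 1) := hb (by omega)
    have a4 : b (n' - 1) < b n' := hb (by omega)
    have b1 : n' < t1 := hb.lt_iff_lt.1 (by omega)
    have b2 : t2 < n' := hb.lt_iff_lt.1 (by omega)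
    have b3 : n < t3 := hb.lt_iff_lt.1 (by omega)
    have b4 : t4 < n := hb.lt_iff_lt.1 (by omega)
    have c1 := hb.monotone (show n' + 1 ≤ t1 by omega)
    have c2 := hb.monotone (show t2 ≤ n' - 1 by omega)
    have c3 := hb.monotone (show n + 1 ≤ t3 by omega)
    have c4 := hb.monotone (show t4 ≤ n - 1 by omega)
    omega
  have hb : ∀ n, b (n + l') = b n + l := by
    intro n
    induction n using Int.induction_on with
    | zero => rw [zero_add, hl']
    | succ n ih => rw [add_right_comm]; exact (key _ _ ih).1
    | pred n ih => rw [sub_add_eq_add_sub]; exact (key _ _ ih).2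
  refine ⟨k, l', fun m n => hs (hz _ _) (hz _ _) (Prod.ext ?_ ?_), fun _ => rfl, hb⟩
  · rw [← h.fst, ← h.fst, hb, hy]
  · have h1 := h.height (m + k) (n + l')
    have h2 := h.height m n
    have h3 := h.snd (m + k) (n + l')
    have h4 := h.snd m n
    rw [add_right_comm, hb, hb, h2] at h1
    cases e : (s (z (m + k) (n + l'))).2 <;> cases e' : (s (z m n)).2 <;> simp only [e, e'] at h1
    · rfl
    · simp at h1; omega
    · simp at h1; omega
    · rw [← h3 _ e, ← h4 _ e', hb, add_right_comm, hy]

/-! ### Desubstitution -/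

/-- Two consecutive integers never both fail `P`, so the next element of `P` is one or two steps
away, and likewise the previous one. "Next" is thus a permutation of `P`, and its integer powers
applied to one point give the enumeration. -/
theorem exists_breaks (P : ℤ → Prop) (h : ∀ q, P q ∨ P (q + 1)) :
    ∃ b : ℤ → ℤ, (∀ n, P (b n)) ∧ ∀ n, (P (b n + 1) ∧ b (n + 1) = b n + 1) ∨
      (¬ P (b n + 1) ∧ b (n + 1) = b n + 2) := by
  classical
  have h2 : ∀ q, ¬ P (q + 1) → P (q + 2) := fun q hq => by
    have := h (q + 1)
    rw [add_assoc, one_add_one_eq_two] at this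
    tauto
  have h3 : ∀ q, ¬ P (q - 1) → P (q - 2) := fun q hq => by
    have := h (q - 2)
    rw [show q - 2 + 1 = q - 1 by ring] at this
    tauto
  let e : Equiv.Perm {q // P q} :=
    { toFun := fun q => if hq : P (q + 1) then ⟨q + 1, hq⟩ else ⟨q + 2, h2 q hq⟩
      invFun := fun q => if hq : P (q - 1) then ⟨q - 1, hq⟩ else ⟨q - 2, h3 q hq⟩
      left_inv := by
        rintro ⟨q, hq⟩
        by_cases h1 : P (q + 1)
        · simp [h1, hq]
        · simp [h1, show q + 2 - 1 = q + 1 by ring]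
      right_inv := by
        rintro ⟨q, hq⟩
        by_cases h1 : P (q - 1)
        · simp [h1, hq]
        · simp [h1, show q - 2 + 1 = q - 1 by ring] }
  obtain ⟨q0, hq0⟩ : ∃ q, P q := (h 0).elim (fun h => ⟨_, h⟩) (fun h => ⟨_, h⟩)
  refine ⟨fun n => ((e ^ n) ⟨q0, hq0⟩).1, fun n => ((e ^ n) ⟨q0, hq0⟩).2, fun n => ?_⟩
  simp only [add_comm n 1, zpow_add, zpow_one, Equiv.Perm.mul_apply]
  generalize (e ^ n) ⟨q0, hq0⟩ = q
  by_cases hq : P (q + 1)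
  · left; simp [e, hq]
  · right; simp [e, hq]

/-- If the markers fill whole rows and no two of these are adjacent, then the configuration is
cut into columns of height one and two. -/
theorem exists_isStacking {s : C → B × Option B} {L : Set C} {y : ℤ → ℤ → B} {top : Bool}
    {M : B → Prop} (hrow : ∀ m n, M (y m n) ↔ M (y (m + 1) n))
    (hcol : ∀ m n, ¬ (M (y m n) ∧ M (y m (n + 1))))
    (h1 : ∀ m n, ¬ Joined top M (y m (n - 1)) (y m n) → ¬ Joined top M (y m n) (y m (n + 1)) →
      ∃ c ∈ L, s c = (y m n, none))
    (h2 : ∀ m n, Joined top M (y m n) (y m (n + 1)) → ∃ c ∈ L, s c = (y m n, some (y m (n + 1)))) :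
    ∃ z b, IsStacking s z y b ∧ ∀ m n, z m n ∈ L := by
  classical
  have hrow' : ∀ m n, M (y m n) ↔ M (y 0 n) := by
    intro m n
    induction m using Int.induction_on with
    | zero => rfl
    | succ m ih => rw [← hrow, ih]
    | pred m ih => rw [hrow, sub_add_cancel, ih]
  -- Markers fill whole rows, so the cuts read off in the column over 0 are correct for every
  -- column.
  have hJ : ∀ m n n', Joined top M (y m n) (y m n') ↔ Joined top M (y 0 n) (y 0 n') := by
    intro m n n'
    unfold Joined
    split_ifs <;> exact hrow' _ _
  obtain ⟨b, hb, hb'⟩ := exists_breaks (fun q => ¬ Joined top M (y 0 (q - 1)) (y 0 q)) (fun q => by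
    have c1 := hcol 0 (q - 1)
    have c2 := hcol 0 q
    rw [sub_add_cancel] at c1
    simp only [add_sub_cancel_right]
    unfold Joined
    split_ifs <;> tauto)
  simp only [add_sub_cancel_right] at hb hb'
  have ex : ∀ m n, ∃ c ∈ L, s c = (y m (b n),
      if Joined top M (y 0 (b n)) (y 0 (b n + 1)) then some (y m (b n + 1)) else none) := by
    intro m n
    split_ifs with hj
    · exact h2 _ _ ((hJ _ _ _).2 hj)
    · exact h1 _ _ (fun h => hb n ((hJ _ _ _).1 h)) (fun h => hj ((hJ _ _ _).1 h))
  choose z hzL hz using ex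
  refine ⟨z, b, ⟨fun m n => ?_, fun m n => by rw [hz], fun m n v hv => ?_⟩, hzL⟩
  · rw [hz]
    rcases hb' n with ⟨h, e⟩ | ⟨h, e⟩
    · simp [h, e]
    · simp [not_not.1 h, e]
  · rw [hz] at hv
    by_cases hj : Joined top M (y 0 (b n)) (y 0 (b n + 1))
    · simpa [hj] using hv
    · simp [hj] at hv

/-- Horizontal adjacency of columns. -/
def StackH (H : B → B → Prop) (e f : B × Option B) : Prop :=
  H e.1 f.1 ∧ match e.2, f.2 with
    | none, none => True
    | some u, some v => H u v
    | _, _ => False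

/-- Vertical adjacency of columns. -/
def StackV (V : B → B → Prop) (e f : B × Option B) : Prop := V (e.2.getD e.1) f.1

instance (H : B → B → Prop) [DecidableRel H] (e f : B × Option B) : Decidable (StackH H e f) := by
  unfold StackH; split <;> infer_instance

instance (V : B → B → Prop) [DecidableRel V] (e f : B × Option B) : Decidable (StackV V e f) := by
  unfold StackV; infer_instance

theorem IsStacking.stackH {s : C → B × Option B} {z : ℤ → ℤ → C} {y : ℤ → ℤ → B} {b : ℤ → ℤ}
    (h : IsStacking s z y b) {H : B → B → Prop} (hH : ∀ m n, H (y m n) (y (m + 1) n)) (m n : ℤ) :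
    StackH H (s (z m n)) (s (z (m + 1) n)) := by
  refine ⟨by rw [← h.fst, ← h.fst]; exact hH _ _, ?_⟩
  have h1 := h.height m n
  have h2 := h.height (m + 1) n
  have h3 := h.snd m n
  have h4 := h.snd (m + 1) n
  cases e : (s (z m n)).2 <;> cases e' : (s (z (m + 1) n)).2 <;> simp only [e, e'] at h1 h2 ⊢
  · simp at h1 h2; omega
  · simp at h1 h2; omega
  · rw [← h3 _ e, ← h4 _ e']; exact hH _ _

theorem IsStacking.stackV {s : C → B × Option B} {z : ℤ → ℤ → C} {y : ℤ → ℤ → B} {b : ℤ → ℤ}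
    (h : IsStacking s z y b) {V : B → B → Prop} (hV : ∀ m n, V (y m n) (y m (n + 1))) (m n : ℤ) :
    StackV V (s (z m n)) (s (z m (n + 1))) := by
  unfold StackV
  rw [← h.fst m n, ← h.fst m (n + 1), h.height m n]
  have h3 := h.snd m n
  cases e : (s (z m n)).2 with
  | none => simpa using hV _ _
  | some v =>
    rw [Option.getD_some, ← h3 v e]
    simpa [add_assoc] using hV m (b n + 1)

end Blocks
section Repetitivity

variable {A B C : Type*}

/-! ### Repetitivity and periods -/

/-- Every square of side `N` of a configuration in `X` occurs in all configurations in `X`. -/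
def SquaresRecur (X : Set (ℤ → ℤ → A)) (N : ℕ) : Prop :=
  ∀ x ∈ X, ∀ z ∈ X, ∀ p q : ℤ, ∃ p' q' : ℤ, ∀ i j : ℕ, i < N → j < N →
    x (p + i) (q + j) = z (p' + i) (q' + j)

theorem SquaresRecur.mono {X : Set (ℤ → ℤ → A)} {N K : ℕ} (h : SquaresRecur X N) (hK : K ≤ N) :
    SquaresRecur X K := by
  intro x hx z hz p q
  obtain ⟨p', q', h⟩ := h x hx z hz p q
  exact ⟨p', q', fun i j hi hj => h i j (by omega) (by omega)⟩

/-- Blocks of letters that agree have images that agree. -/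
theorem Blocks.Image.agree {F : Blocks A B} {y y' : ℤ → ℤ → B} {x x' : ℤ → ℤ → A}
    {a b a' b' : ℤ → ℤ} (h : F.Image y x a b) (h' : F.Image y' x' a' b')
    (ha : ∀ m, a m < a (m + 1)) (hb : ∀ n, b n < b (n + 1)) {N : ℕ} (hN : 0 < N) {p q p' q' : ℤ}
    (hy : ∀ i j : ℕ, i < N → j < N → y (p + i) (q + j) = y' (p' + i) (q' + j)) {P Q : ℤ}
    (hP : a p ≤ P) (hQ : b q ≤ Q) (hP' : P < a (p + N)) (hQ' : Q < b (q + N)) :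
    x P Q = x' (a' p' + (P - a p)) (b' q' + (Q - b q)) := by
  -- Widths and heights of blocks are determined by letters, so equal squares of letters produce the
  -- same grid up to translation.
  have ea : ∀ s : ℕ, s ≤ N → a' (p' + s) - a' p' = a (p + s) - a p := by
    intro s
    induction s with
    | zero => simp
    | succ s ih =>
      intro hs
      have h1 := h.width (p + s) q
      have h2 := h'.width (p' + s) q'
      have h3 := hy s 0 (by omega) hN
      simp only [Nat.cast_zero, add_zero] at h3
      rw [← h3] at h2
      have := ih (by omega)
      push_cast
      rw [← add_assoc, ← add_assoc]
      omega
  have eb : ∀ s : ℕ, s ≤ N → b' (q' + s) - b' q' = b (q + s) - b q := by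
    intro s
    induction s with
    | zero => simp
    | succ s ih =>
      intro hs
      have h1 := h.height p (q + s)
      have h2 := h'.height p' (q' + s)
      have h3 := hy 0 s hN (by omega)
      simp only [Nat.cast_zero, add_zero] at h3
      rw [← h3] at h2
      have := ih (by omega)
      push_cast
      rw [← add_assoc, ← add_assoc]
      omega
  have ma := strictMono_int_of_lt_succ ha
  have mb := strictMono_int_of_lt_succ hb
  obtain ⟨m, hm1, hm2⟩ := exists_cell a ha P
  obtain ⟨n, hn1, hn2⟩ := exists_cell b hb Q
  have c1 : p < m + 1 := ma.lt_iff_lt.1 (by omega)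
  have c2 : m < p + N := ma.lt_iff_lt.1 (by omega)
  have c3 : q < n + 1 := mb.lt_iff_lt.1 (by omega)
  have c4 : n < q + N := mb.lt_iff_lt.1 (by omega)
  obtain ⟨s, rfl⟩ : ∃ s : ℕ, m = p + s := ⟨(m - p).toNat, by omega⟩
  obtain ⟨t, rfl⟩ : ∃ t : ℕ, n = q + t := ⟨(n - q).toNat, by omega⟩
  have hs : s < N := by omega
  have ht : t < N := by omega
  obtain ⟨i, hi⟩ : ∃ i : ℕ, P = a (p + s) + i := ⟨(P - a (p + s)).toNat, by omega⟩
  obtain ⟨j, hj⟩ : ∃ j : ℕ, Q = b (q + t) + j := ⟨(Q - b (q + t)).toNat, by omega⟩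
  have w := h.width (p + s) (q + t)
  have v := h.height (p + s) (q + t)
  have e := hy s t hs ht
  have l1 := h.letter (p + s) (q + t) i j (by omega) (by omega)
  have l2 := h'.letter (p' + s) (q' + t) i j (by rw [← e]; omega) (by rw [← e]; omega)
  have e1 := ea s hs.le
  have e2 := eb t ht.le
  rw [show a' p' + (P - a p) = a' (p' + s) + i by omega,
    show b' q' + (Q - b q) = b' (q' + t) + j by omega, l2, ← e, hi, hj, l1]

theorem le_of_le_increments {a : ℤ → ℤ} {t : ℕ} (ha : ∀ m, a m + t ≤ a (m + 1)) (m : ℤ) (N : ℕ) :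
    a m + t * N ≤ a (m + N) := by
  induction N with
  | zero => simp
  | succ N ih =>
    have := ha (m + N)
    push_cast
    rw [← add_assoc]
    linarith

/-- A window of side `t * N + 1` starts somewhere in a first block, and the `N` blocks after it have
total length at least `t * N`. Hence `N + 1` letters of the preimage cover the window in each
direction. -/
theorem SquaresRecur.of_image {X : Set (ℤ → ℤ → A)} {Y : Set (ℤ → ℤ → B)} (F : Blocks A B)
    {t N : ℕ} (ht : 0 < t) (h : SquaresRecur Y (N + 1))
    (hX : ∀ x ∈ X, ∃ y ∈ Y, ∃ a b, F.Image y x a b ∧ (∀ m, a m + t ≤ a (m + 1)) ∧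
      ∀ n, b n + t ≤ b (n + 1)) : SquaresRecur X (t * N + 1) := by
  intro x hx z hz P Q
  obtain ⟨y, hy, a, b, hF, ha, hb⟩ := hX x hx
  obtain ⟨y', hy', a', b', hF', ha', hb'⟩ := hX z hz
  have la : ∀ m, a m < a (m + 1) := fun m => by have := ha m; omega
  have lb : ∀ m, b m < b (m + 1) := fun m => by have := hb m; omega
  obtain ⟨p, hp1, hp2⟩ := exists_cell a la P
  obtain ⟨q, hq1, hq2⟩ := exists_cell b lb Q
  obtain ⟨p', q', hpq⟩ := h y hy y' hy' p q
  have ka := le_of_le_increments ha (p + 1) N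
  have kb := le_of_le_increments hb (q + 1) N
  refine ⟨a' p' + (P - a p), b' q' + (Q - b q), fun i j hi hj => ?_⟩
  have hi' : (i : ℤ) < t * N + 1 := by exact_mod_cast hi
  have hj' : (j : ℤ) < t * N + 1 := by exact_mod_cast hj
  have e1 : p + ((N + 1 : ℕ) : ℤ) = p + 1 + N := by push_cast; ring
  have e2 : q + ((N + 1 : ℕ) : ℤ) = q + 1 + N := by push_cast; ring
  rw [hF.agree hF' la lb N.succ_pos hpq (P := P + i) (Q := Q + j) (by omega) (by omega)
    (by rw [e1]; linarith) (by rw [e2]; linarith)]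
  congr 1 <;> ring

/-- If `X` is self-similar with an expansion by at least two, then squares of side two are enough
for repetitivity. -/
theorem SquaresRecur.of_selfSimilar {X : Set (ℤ → ℤ → A)} (F : Blocks A A)
    (h : SquaresRecur X 2) (hX : ∀ x ∈ X, ∃ y ∈ X, ∃ a b, F.Image y x a b ∧
      (∀ m, a m + (2 : ℕ) ≤ a (m + 1)) ∧ ∀ n, b n + (2 : ℕ) ≤ b (n + 1)) (N : ℕ) :
    SquaresRecur X N := by
  -- With `t = 2`, side `2 ^ k + 1` yields `2 * 2 ^ k + 1`. Side two is the case `k = 0` and the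
  -- smallest from which the recursion grows; side one would reproduce itself.
  have key : ∀ k : ℕ, SquaresRecur X (2 ^ k + 1) := by
    intro k
    induction k with
    | zero => exact h
    | succ k ih => rw [pow_succ, mul_comm]; exact ih.of_image F two_pos hX
  exact (key N).mono (Nat.lt_two_pow_self.le.trans (Nat.le_succ _))

/-- `x` has no nonzero period. -/
def NoPeriod (x : ℤ → ℤ → A) : Prop :=
  ∀ k l, (∀ m n, x (m + k) (n + l) = x m n) → k = 0 ∧ l = 0

theorem NoPeriod.of_recognizes {y : ℤ → ℤ → B} {x : ℤ → ℤ → A} {a b : ℤ → ℤ} (hy : NoPeriod y)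
    (h : Recognizes y x a b) : NoPeriod x := by
  intro k l hx
  obtain ⟨k', l', hy', ha, hb⟩ := h k l hx
  obtain ⟨rfl, rfl⟩ := hy k' l' hy'
  have h1 := ha 0
  have h2 := hb 0
  simp only [add_zero] at h1 h2
  omega

theorem two_mul_natAbs_le {a : ℤ → ℤ} (ha : ∀ m, a m + (2 : ℕ) ≤ a (m + 1)) {k k' : ℤ}
    (h : ∀ m, a (m + k') = a m + k) : 2 * k'.natAbs ≤ k.natAbs := by
  rcases le_total 0 k' with hk | hk
  · have h1 := le_of_le_increments ha 0 k'.natAbs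
    have h2 := h 0
    rw [Int.natAbs_of_nonneg hk, h2] at h1
    push_cast at h1
    omega
  · have h1 := le_of_le_increments ha k' k'.natAbs
    have h2 := h 0
    rw [Int.ofNat_natAbs_of_nonpos hk, add_neg_cancel] at h1
    rw [zero_add] at h2
    push_cast at h1
    omega

/-- A recognizable self-similarity with an expansion by at least two excludes periods. -/
theorem noPeriod_of_selfSimilar {X : Set (ℤ → ℤ → A)} (hX : ∀ x ∈ X, ∃ y ∈ X, ∃ a b,
    Recognizes y x a b ∧ (∀ m, a m + (2 : ℕ) ≤ a (m + 1)) ∧ ∀ n, b n + (2 : ℕ) ≤ b (n + 1)) :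
    ∀ x ∈ X, NoPeriod x := by
  -- Descent on the size of the period: its lift to the desubstituted configuration is at most half
  -- as large.
  have key : ∀ N : ℕ, ∀ x ∈ X, ∀ k l, (∀ m n, x (m + k) (n + l) = x m n) →
      k.natAbs + l.natAbs ≤ N → k = 0 ∧ l = 0 := by
    intro N
    induction N with
    | zero => intro x _ k l _ h; omega
    | succ N ih =>
      intro x hx k l hp hN
      obtain ⟨y, hy, a, b, hr, ha, hb⟩ := hX x hx
      obtain ⟨k', l', hy', hka, hlb⟩ := hr k l hp
      have h1 := two_mul_natAbs_le ha hka
      have h2 := two_mul_natAbs_le hb hlb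
      obtain ⟨rfl, rfl⟩ := ih y hy k' l' hy' (by omega)
      have h1 := hka 0
      have h2 := hlb 0
      simp only [add_zero] at h1 h2
      omega
  exact fun x hx k l h => key _ x hx k l h le_rfl

/-! ### Substitutions that preserve adjacency -/

/-- The blocks of `F` respect the adjacency relations `H₀` and `V₀`, and so do the blocks of
letters that are adjacent for `H` and `V`. -/
structure Blocks.Valid (F : Blocks A B) (H₀ V₀ : A → A → Prop) (H V : B → B → Prop) : Prop where
  width_pos : ∀ c, 0 < F.width c
  height_pos : ∀ c, 0 < F.height c
  innerH : ∀ c i j, i + 1 < F.width c → j < F.height c → H₀ (F.letter c i j) (F.letter c (i + 1) j)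
  innerV : ∀ c i j, i < F.width c → j + 1 < F.height c → V₀ (F.letter c i j) (F.letter c i (j + 1))
  hor : ∀ c d, H c d → F.height c = F.height d ∧
    ∀ j < F.height c, H₀ (F.letter c (F.width c - 1) j) (F.letter d 0 j)
  ver : ∀ c d, V c d → F.width c = F.width d ∧
    ∀ i < F.width c, V₀ (F.letter c i (F.height c - 1)) (F.letter d i 0)

theorem Blocks.unit_valid (H V : A → A → Prop) : (Blocks.unit A).Valid H V H V := by
  refine ⟨fun _ => one_pos, fun _ => one_pos, ?_, ?_, fun c d h => ⟨rfl, fun _ _ => h⟩,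
    fun c d h => ⟨rfl, fun _ _ => h⟩⟩
  · intro c i j hi; simp [unit] at hi
  · intro c i j _ hj; simp [unit] at hj

theorem Blocks.Valid.transpose {F : Blocks A B} {H₀ V₀ : A → A → Prop} {H V : B → B → Prop}
    (h : F.Valid H₀ V₀ H V) : F.transpose.Valid V₀ H₀ V H :=
  ⟨h.height_pos, h.width_pos, fun c i j hi hj => h.innerV c j i hj hi,
    fun c i j hi hj => h.innerH c j i hj hi, h.ver, h.hor⟩

/-- The two letters of a column are adjacent for `V`, so their blocks have equal width and match
along the inner seam. Outer edges are handled by `StackH` row by row and by `StackV` through the top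
letter of the lower column and the bottom letter of the upper one. -/
theorem Blocks.Valid.vstack {F : Blocks A B} {H₀ V₀ : A → A → Prop} {H V : B → B → Prop}
    (h : F.Valid H₀ V₀ H V) {s : C → B × Option B} {H' V' : C → C → Prop}
    (hs : ∀ c v, (s c).2 = some v → V (s c).1 v) (hH : ∀ c d, H' c d → StackH H (s c) (s d))
    (hV : ∀ c d, V' c d → StackV V (s c) (s d)) : (F.vstack s).Valid H₀ V₀ H' V' := by
  have hw : ∀ c v, (s c).2 = some v → F.width (s c).1 = F.width v :=
    fun c v e => (h.ver _ _ (hs c v e)).1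
  refine ⟨fun c => h.width_pos _, fun c => ?_, fun c i j hi hj => ?_, fun c i j hi hj => ?_,
    fun c d hcd => ?_, fun c d hcd => ?_⟩
  · have := h.height_pos (s c).1
    simp only [Blocks.vstack]; omega
  · simp only [Blocks.vstack] at hi hj ⊢
    split_ifs with hlt
    · exact h.innerH _ _ _ hi hlt
    · cases e : (s c).2 with
      | none => rw [e] at hj; exact absurd hj (by simpa using hlt)
      | some v =>
        rw [e] at hj
        rw [hw c v e] at hi
        simp only [Option.elim_some] at hj
        simp only [Option.getD_some]
        exact h.innerH _ _ _ hi (by omega)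
  · simp only [Blocks.vstack] at hi hj ⊢
    cases e : (s c).2 with
    | none =>
      simp only [e, Option.elim_none, add_zero] at hj
      rw [if_pos (by omega), if_pos hj]
      exact h.innerV _ _ _ hi hj
    | some v =>
      simp only [e, Option.elim_some] at hj
      simp only [Option.getD_some]
      have hp := h.height_pos (s c).1
      rcases lt_trichotomy (j + 1) (F.height (s c).1) with hlt | heq | hgt
      · rw [if_pos (by omega), if_pos hlt]; exact h.innerV _ _ _ hi hlt
      · have h1 := (h.ver _ _ (hs c v e)).2 i hi
        rw [if_pos (by omega), if_neg (by omega), heq, Nat.sub_self]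
        rwa [← heq, Nat.add_sub_cancel] at h1
      · rw [if_neg (by omega), if_neg (by omega), Nat.sub_add_comm (by omega)]
        rw [hw c v e] at hi
        exact h.innerV _ _ _ hi (by omega)
  · obtain ⟨h1, h2⟩ := hH c d hcd
    obtain ⟨h3, h4⟩ := h.hor _ _ h1
    have hc := h.width_pos (s c).1
    simp only [Blocks.vstack]
    cases e : (s c).2 with
    | none =>
      cases e' : (s d).2 with
      | none => simpa [h3] using fun j hj => by simpa [hj, h3 ▸ hj] using h4 j (h3 ▸ hj)
      | some w => simp [e, e'] at h2
    | some v =>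
      cases e' : (s d).2 with
      | none => simp [e, e'] at h2
      | some w =>
        simp only [e, e'] at h2
        obtain ⟨h5, h6⟩ := h.hor _ _ h2
        refine ⟨by simp [h3, h5], fun j hj => ?_⟩
        simp only [Option.elim_some, Option.getD_some] at hj ⊢
        rw [← h3]
        split_ifs with hlt
        · exact h4 j hlt
        · rw [hw c v e]; exact h6 _ (by omega)
  · have h1 := h.ver _ _ (hV c d hcd)
    have hd := h.height_pos (s d).1
    simp only [Blocks.vstack]
    simp only [hd, if_true]
    cases e : (s c).2 with
    | none =>
      simp only [e, Option.getD_none, Option.elim_none, add_zero] at h1 ⊢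
      have := h.height_pos (s c).1
      refine ⟨h1.1, fun i hi => ?_⟩
      rw [if_pos (by omega)]
      exact h1.2 i hi
    | some v =>
      have hv := h.height_pos v
      have e1 : ¬ F.height (s c).1 + F.height v - 1 < F.height (s c).1 := by omega
      have e2 : F.height (s c).1 + F.height v - 1 - F.height (s c).1 = F.height v - 1 := by omega
      simp only [e, Option.getD_some] at h1
      simp only [Option.elim_some, Option.getD_some, e1, if_false, e2]
      rwa [hw c v e]

end Repetitivity
section Dominoes

/-! ### Tilings given by dominoes -/

/-- Lists of the allowed horizontal and of the allowed vertical dominoes. -/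
abbrev Dominoes := List (ℕ × ℕ) × List (ℕ × ℕ)

/-- All dominoes in `x` are allowed. -/
def IsTiling (D : Dominoes) (x : ℤ → ℤ → ℕ) : Prop :=
  ∀ m n, (x m n, x (m + 1) n) ∈ D.1 ∧ (x m n, x m (n + 1)) ∈ D.2

theorem IsTiling.transpose {D : Dominoes} {x : ℤ → ℤ → ℕ} (h : IsTiling D x) :
    IsTiling D.swap (fun m n => x n m) :=
  fun m n => ⟨(h n m).2, (h n m).1⟩

/-- The pair `(a, b)` occurs in `V`. -/
def hasPair (V : List (ℕ × ℕ)) (a b : ℕ) : Bool := V.any fun e => Nat.beq e.1 a && Nat.beq e.2 b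

theorem hasPair_iff {V : List (ℕ × ℕ)} {a b : ℕ} : hasPair V a b = true ↔ (a, b) ∈ V := by
  simp only [hasPair, List.any_eq_true, Bool.and_eq_true, Nat.beq_eq]
  exact ⟨fun ⟨e, he, h1, h2⟩ => by rwa [← h1, ← h2], fun h => ⟨_, h, rfl, rfl⟩⟩

/-- The vertical domino `e` has a right and a left neighbour. -/
def hasNeighbours (H V : List (ℕ × ℕ)) (e : ℕ × ℕ) : Bool :=
  (H.any fun f => Nat.beq f.1 e.1 && H.any fun g => Nat.beq g.1 e.2 && hasPair V f.2 g.2) &&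
  H.any fun f => Nat.beq f.2 e.1 && H.any fun g => Nat.beq g.2 e.2 && hasPair V f.1 g.1

/-- Remove the vertical dominoes without a right or a left neighbour. -/
def pruneVertical (D : Dominoes) : Dominoes := (D.1, D.2.filter (hasNeighbours D.1 D.2))

/-- Remove dominoes without neighbours. -/
def prune (D : Dominoes) : Dominoes := (pruneVertical (pruneVertical D).swap).swap

theorem IsTiling.pruneVertical {D : Dominoes} {x : ℤ → ℤ → ℕ} (h : IsTiling D x) :
    IsTiling (pruneVertical D) x := by
  refine fun m n => ⟨(h m n).1, List.mem_filter.2 ⟨(h m n).2, ?_⟩⟩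
  simp only [hasNeighbours, Bool.and_eq_true, List.any_eq_true, Nat.beq_eq, hasPair_iff]
  refine ⟨⟨_, (h m n).1, rfl, _, (h m (n + 1)).1, rfl, (h (m + 1) n).2⟩, ?_⟩
  have h1 := (h (m - 1) n).1
  have h2 := (h (m - 1) (n + 1)).1
  rw [sub_add_cancel] at h1 h2
  exact ⟨_, h1, rfl, _, h2, rfl, (h (m - 1) n).2⟩

theorem IsTiling.prune_iterate {D : Dominoes} {x : ℤ → ℤ → ℕ} (h : IsTiling D x) (k : ℕ) :
    IsTiling (prune^[k] D) x := by
  induction k with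
  | zero => exact h
  | succ k ih =>
    rw [Function.iterate_succ_apply']
    exact ih.pruneVertical.transpose.pruneVertical.transpose

/-- Used in the opposite direction to `IsTiling.prune_iterate`: validity of blocks for a list of
dominoes is inherited by every smaller list. -/
theorem prune_iterate_subset (D : Dominoes) (k : ℕ) :
    (prune^[k] D).1 ⊆ D.1 ∧ (prune^[k] D).2 ⊆ D.2 := by
  induction k with
  | zero => exact ⟨List.Subset.refl _, List.Subset.refl _⟩
  | succ k ih =>
    rw [Function.iterate_succ_apply']
    exact ⟨fun e he => ih.1 (List.mem_filter.1 he).1, fun e he => ih.2 (List.mem_filter.1 he).1⟩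

/-- The substitution by columns with the images listed in `S`. -/
def stack (S : List (ℕ × Option ℕ)) (c : ℕ) : ℕ × Option ℕ := S.getD c (0, none)

/-- The dominoes of indices of columns that respect the dominoes `D`. -/
def fuse (D : Dominoes) (S : List (ℕ × Option ℕ)) : Dominoes :=
  let r := List.range S.length
  ((r ×ˢ r).filter fun e => StackH (fun u v => (u, v) ∈ D.1) (stack S e.1) (stack S e.2),
    (r ×ˢ r).filter fun e => StackV (fun u v => (u, v) ∈ D.2) (stack S e.1) (stack S e.2))

/-- The markers `M` fill whole rows, no two of which are adjacent, and the columns that arise when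
the rows of markers are joined with the rows below (`top = true`) or above them are listed in `S`.
The tilings by these columns are described by `D'`. -/
def IsFusion (top : Bool) (M : List ℕ) (S : List (ℕ × Option ℕ)) (k : ℕ) (D D' : Dominoes) : Prop :=
  ((∀ e ∈ D.1, e.1 ∈ M ↔ e.2 ∈ M) ∧ ∀ e ∈ D.2, ¬ (e.1 ∈ M ∧ e.2 ∈ M)) ∧
  (∀ e ∈ D.2, Joined top (· ∈ M) e.1 e.2 → (e.1, some e.2) ∈ S) ∧
  (∀ e ∈ D.2, ∀ f ∈ D.2, e.2 = f.1 → Joined top (· ∈ M) e.1 e.2 ∨ Joined top (· ∈ M) f.1 f.2 ∨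
    (e.2, none) ∈ S) ∧
  (∀ e ∈ S, Marked top (· ∈ M) e ∧ ∀ v ∈ e.2.toList, (e.1, v) ∈ D.2) ∧ S.Nodup ∧
  prune^[k] (fuse D S) = D'

instance (top : Bool) (M : List ℕ) (S : List (ℕ × Option ℕ)) (k : ℕ) (D D' : Dominoes) :
    Decidable (IsFusion top M S k D D') := by
  have (u v : ℕ) : Decidable (Joined top (· ∈ M) u v) := inferInstance
  unfold IsFusion; infer_instance

theorem stack_mem {S : List (ℕ × Option ℕ)} {c : ℕ} (hc : c < S.length) : stack S c ∈ S := by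
  rw [stack, List.getD_eq_getElem _ _ hc]
  exact List.getElem_mem hc

theorem exists_stack_eq {S : List (ℕ × Option ℕ)} {e : ℕ × Option ℕ} (he : e ∈ S) :
    ∃ c ∈ {c | c < S.length}, stack S c = e := by
  obtain ⟨c, hc, rfl⟩ := List.mem_iff_getElem.1 he
  exact ⟨c, hc, List.getD_eq_getElem _ _ hc⟩

/-- One desubstitution step, obtained from decidable conditions on finite lists. Pruning is harmless
because the dominoes it removes occur in no tiling. -/
theorem IsFusion.exists_isStacking {top : Bool} {M : List ℕ} {S : List (ℕ × Option ℕ)} {k : ℕ}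
    {D D' : Dominoes} (h : IsFusion top M S k D D') {y : ℤ → ℤ → ℕ} (hy : IsTiling D y) :
    ∃ z b, IsTiling D' z ∧ IsStacking (stack S) z y b ∧ Recognizes z y id b := by
  obtain ⟨⟨h1, h2⟩, h3, h4, h5, h6, rfl⟩ := h
  obtain ⟨z, b, hs, hz⟩ := JeandelRao.exists_isStacking (s := stack S) (L := {c | c < S.length})
    (y := y) (top := top) (M := (· ∈ M)) (fun m n => h1 _ (hy m n).1) (fun m n => h2 _ (hy m n).2)
    (fun m n hn hn' => exists_stack_eq (by
      have := (hy m (n - 1)).2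
      rw [sub_add_cancel] at this
      exact ((h4 _ this _ (hy m n).2 rfl).resolve_left hn).resolve_left hn'))
    (fun m n hn => exists_stack_eq (h3 _ (hy m n).2 hn))
  refine ⟨z, b, IsTiling.prune_iterate (fun m n => ?_) k, hs,
    hs.recognizes (fun m n => (h5 _ (stack_mem (hz m n))).1) _ hz ?_⟩
  · have c1 := hs.stackH (H := fun u v => (u, v) ∈ D.1) (fun m n => (hy m n).1) m n
    have c2 := hs.stackV (V := fun u v => (u, v) ∈ D.2) (fun m n => (hy m n).2) m n
    simp only [fuse, List.mem_filter, List.mem_product, List.mem_range, decide_eq_true_eq]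
    exact ⟨⟨⟨hz _ _, hz _ _⟩, c1⟩, ⟨hz _ _, hz _ _⟩, c2⟩
  · intro c hc d hd e
    simp only [stack] at e
    rw [List.getD_eq_getElem _ _ hc, List.getD_eq_getElem _ _ hd] at e
    exact (List.Nodup.getElem_inj_iff h6).1 e

/-- The converse direction, from letters to patches: it is what allows large valid patches to be
built by substitution. -/
theorem IsFusion.valid {top : Bool} {M : List ℕ} {S : List (ℕ × Option ℕ)} {k : ℕ}
    {D D' : Dominoes} (h : IsFusion top M S k D D') {A : Type*} {F : Blocks A ℕ}
    {H V : A → A → Prop} (hF : F.Valid H V (fun u v => (u, v) ∈ D.1) fun u v => (u, v) ∈ D.2) :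
    (F.vstack (stack S)).Valid H V (fun u v => (u, v) ∈ D'.1) fun u v => (u, v) ∈ D'.2 := by
  obtain ⟨-, -, -, h5, -, rfl⟩ := h
  obtain ⟨c1, c2⟩ := prune_iterate_subset (fuse D S) k
  refine hF.vstack (fun c v hv => ?_) (fun c d hcd => ?_) (fun c d hcd => ?_)
  -- Indices outside the list take the default `(0, none)`, which has no second letter, so nothing
  -- is to be checked there.
  · rcases lt_or_ge c S.length with hc | hc
    · exact (h5 _ (stack_mem hc)).2 v (by simp [hv])
    · simp [stack, hc] at hv
  · simpa using (List.mem_filter.1 (c1 hcd)).2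
  · simpa using (List.mem_filter.1 (c2 hcd)).2

/-- `D'` describes the desubstituted tilings of `D` for the substitution by rows or columns listed
in `S`. -/
def IsRowFusion (top : Bool) (M : List ℕ) (S : List (ℕ × Option ℕ)) (k : ℕ) (D D' : Dominoes) :
    Prop := IsFusion top M S k D.swap D'.swap

instance (top : Bool) (M : List ℕ) (S : List (ℕ × Option ℕ)) (k : ℕ) (D D' : Dominoes) :
    Decidable (IsRowFusion top M S k D D') := by
  unfold IsRowFusion; infer_instance

end Dominoes

/-! ### Data: domino lists and substitutions of the desubstitution chain. -/

/-- The dominoes of the sheared tilings by `𝒯₅`. -/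
def dominoes6 : Dominoes :=
  ([(0, 2), (0, 10), (1, 0), (2, 11), (3, 10), (4, 12), (5, 1), (5, 9), (6, 5), (7, 4), (8, 4),
  (9, 8), (10, 6), (10, 7), (11, 3), (12, 3), (13, 21), (14, 22), (14, 23), (14, 27), (15, 20),
  (16, 15), (17, 15), (18, 14), (19, 14), (20, 19), (21, 16), (21, 18), (22, 28), (23, 13), (24,
  23), (24, 27), (25, 17), (25, 19), (26, 25), (27, 26), (28, 24)], [(0, 13), (1, 23), (2, 21),
  (3, 13), (3, 14), (3, 15), (4, 24), (4, 25), (5, 14), (6, 18), (6, 19), (7, 28), (8, 26), (9,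
  27), (10, 20), (10, 21), (10, 22), (11, 16), (11, 18), (12, 17), (12, 19), (12, 23), (13, 0),
  (13, 13), (13, 14), (13, 15), (14, 3), (14, 5), (14, 24), (14, 25), (15, 0), (15, 14), (16,
  18), (16, 19), (17, 1), (17, 19), (18, 11), (18, 28), (19, 6), (19, 12), (19, 26), (20, 10),
  (20, 27), (21, 2), (21, 20), (21, 21), (21, 22), (22, 10), (22, 27), (23, 1), (23, 17), (23,
  19), (23, 23), (24, 5), (24, 25), (25, 4), (25, 5), (25, 25), (26, 6), (26, 7), (26, 8), (26,
  26), (27, 9), (27, 10), (27, 27), (28, 6), (28, 26)])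

/-- The dominoes of the tilings by indices of the entries of `stack6`. -/
def dominoes7 : Dominoes :=
  ([(0, 11), (1, 10), (2, 8), (2, 9), (3, 16), (4, 13), (4, 15), (5, 19), (6, 18), (7, 0), (7,
  2), (8, 1), (8, 7), (9, 12), (10, 12), (11, 2), (12, 2), (13, 3), (14, 3), (15, 5), (15, 6),
  (15, 17), (16, 5), (16, 6), (16, 17), (17, 4), (18, 14), (18, 16), (19, 6), (19, 17)], [(0, 4),
  (1, 6), (2, 3), (2, 4), (2, 5), (3, 2), (3, 6), (4, 0), (4, 3), (4, 4), (4, 5), (5, 2), (5, 6),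
  (6, 1), (6, 2), (6, 6), (7, 17), (8, 15), (8, 16), (9, 19), (10, 18), (11, 13), (11, 15), (12,
  14), (12, 16), (12, 17), (13, 15), (13, 16), (14, 7), (14, 16), (15, 11), (15, 19), (16, 8),
  (16, 12), (16, 18), (17, 7), (17, 14), (17, 16), (17, 17), (18, 8), (18, 9), (18, 10), (18,
  18), (19, 8), (19, 18)])

/-- The dominoes of the tilings by indices of the entries of `stack7`. -/
def dominoes8 : Dominoes :=
  ([(0, 5), (0, 7), (1, 7), (1, 8), (2, 9), (3, 12), (3, 13), (4, 10), (4, 11), (5, 7), (5, 8),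
  (6, 1), (7, 0), (7, 6), (8, 1), (9, 4), (9, 13), (10, 9), (11, 4), (11, 12), (11, 13), (12, 4),
  (12, 13), (13, 2), (13, 3)], [(0, 4), (1, 2), (1, 3), (1, 4), (2, 0), (2, 3), (3, 1), (4, 0),
  (4, 2), (4, 3), (4, 4), (5, 10), (5, 11), (6, 13), (7, 9), (7, 11), (8, 12), (9, 7), (9, 13),
  (10, 9), (10, 11), (11, 5), (11, 12), (12, 7), (12, 13), (13, 6), (13, 7), (13, 8), (13, 13)])

/-- The dominoes of the tilings by indices of the entries of `stack8`. -/
def dominoes9 : Dominoes :=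
  ([(0, 7), (0, 8), (1, 6), (2, 13), (3, 9), (4, 11), (4, 12), (4, 13), (5, 13), (6, 1), (6, 7),
  (6, 8), (7, 0), (7, 1), (7, 7), (8, 1), (8, 7), (9, 3), (9, 4), (9, 10), (10, 3), (11, 4), (11,
  10), (12, 2), (12, 9), (13, 5), (13, 11), (13, 12), (13, 13)], [(0, 3), (0, 4), (1, 2), (1, 4),
  (2, 1), (3, 2), (3, 4), (4, 0), (4, 5), (5, 1), (6, 12), (6, 13), (7, 9), (7, 10), (8, 11), (9,
  7), (9, 12), (9, 13), (10, 11), (11, 7), (11, 13), (12, 7), (12, 13), (13, 6), (13, 8)])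

/-- The dominoes of the tilings by indices of the entries of `stack9`. -/
def dominoes10 : Dominoes :=
  ([(0, 2), (1, 4), (1, 5), (2, 0), (2, 1), (2, 3), (3, 0), (4, 1), (4, 3), (5, 2), (6, 12), (7,
  10), (7, 11), (7, 13), (8, 12), (9, 7), (10, 7), (11, 6), (11, 9), (12, 8), (12, 10), (12, 11),
  (12, 13), (13, 8), (13, 10)], [(0, 6), (0, 7), (1, 8), (2, 11), (2, 12), (2, 13), (3, 10), (4,
  12), (5, 12), (6, 1), (6, 7), (7, 0), (7, 1), (7, 7), (8, 1), (8, 6), (8, 7), (9, 3), (10, 2),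
  (10, 3), (10, 9), (11, 2), (11, 9), (12, 5), (12, 11), (12, 12), (12, 13), (13, 4), (13, 10)])

/-- The dominoes of the tilings by indices of the entries of `stack10`. -/
def dominoes11 : Dominoes :=
  ([(0, 6), (0, 7), (0, 8), (1, 6), (2, 10), (2, 11), (3, 11), (3, 12), (4, 9), (5, 13), (6, 1),
  (6, 6), (6, 7), (6, 8), (7, 1), (7, 8), (8, 0), (9, 3), (9, 13), (10, 11), (10, 12), (11, 2),
  (11, 9), (12, 3), (12, 13), (13, 3), (13, 4), (13, 5), (13, 13)], [(0, 4), (0, 5), (1, 3), (2,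
  1), (3, 0), (3, 1), (3, 2), (4, 0), (4, 2), (5, 3), (6, 9), (6, 11), (6, 12), (7, 13), (8, 13),
  (9, 8), (9, 11), (10, 6), (11, 6), (12, 7), (12, 10), (13, 8), (13, 9), (13, 11), (13, 12)])

/-- The dominoes of the tilings by indices of the entries of `stack11`. -/
def dominoes12 : Dominoes :=
  ([(0, 3), (0, 4), (1, 4), (1, 5), (2, 1), (3, 4), (3, 5), (4, 0), (4, 2), (5, 1), (6, 9), (7,
  12), (7, 13), (8, 10), (8, 11), (9, 8), (9, 13), (10, 9), (11, 8), (11, 12), (11, 13), (12, 8),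
  (12, 13), (13, 6), (13, 7)], [(0, 8), (1, 6), (1, 7), (1, 8), (2, 13), (3, 10), (3, 11), (4,
  9), (4, 11), (5, 12), (6, 0), (6, 7), (7, 1), (8, 0), (8, 6), (8, 7), (8, 8), (9, 4), (9, 13),
  (10, 9), (10, 11), (11, 3), (11, 12), (12, 4), (12, 13), (13, 2), (13, 4), (13, 5), (13, 13)])

/-- The rows into which the tilings by `dominoes6` are cut. -/
def stack6 : List (ℕ × Option ℕ) :=
  [(2, none), (9, none), (10, none), (20, none), (21, none), (22, none), (27, none), (1, some 0),
  (6, some 5), (7, some 4), (8, some 4), (11, some 3), (12, some 3), (16, some 15), (17, some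
  15), (18, some 14), (19, some 14), (23, some 13), (26, some 25), (28, some 24)]

/-- The rows into which the tilings by `dominoes7` are cut. -/
def stack7 : List (ℕ × Option ℕ) :=
  [(7, none), (12, none), (14, none), (16, none), (17, none), (0, some 11), (1, some 10), (2,
  some 8), (2, some 9), (3, some 16), (4, some 13), (4, some 15), (5, some 19), (6, some 18)]

/-- The rows into which the tilings by `dominoes8` are cut. -/
def stack8 : List (ℕ × Option ℕ) :=
  [(5, none), (7, none), (9, none), (10, none), (11, none), (12, none), (6, some 1), (7, some 0),
  (8, some 1), (9, some 4), (11, some 4), (12, some 4), (13, some 2), (13, some 3)]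

/-- The columns into which the tilings by `dominoes9` are cut. -/
def stack9 : List (ℕ × Option ℕ) :=
  [(3, none), (4, none), (9, none), (10, none), (11, none), (12, none), (2, some 1), (4, some 0),
  (5, some 1), (9, some 7), (11, some 7), (12, some 7), (13, some 6), (13, some 8)]

/-- The rows into which the tilings by `dominoes10` are cut. -/
def stack10 : List (ℕ × Option ℕ) :=
  [(2, none), (3, none), (9, none), (10, none), (11, none), (13, none), (0, some 2), (1, some 4),
  (1, some 5), (6, some 12), (7, some 10), (7, some 11), (7, some 13), (8, some 12)]

/-- The columns into which the tilings by `dominoes11` are cut. -/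
def stack11 : List (ℕ × Option ℕ) :=
  [(2, none), (3, none), (9, none), (10, none), (11, none), (12, none), (0, some 4), (0, some 5),
  (1, some 3), (6, some 9), (6, some 11), (6, some 12), (7, some 13), (8, some 13)]

/-- The rows into which the tilings by `dominoes12` are cut. -/
def stack12 : List (ℕ × Option ℕ) :=
  [(3, none), (4, none), (9, none), (10, none), (11, none), (12, none), (2, some 1), (4, some 0),
  (5, some 1), (9, some 8), (11, some 8), (12, some 8), (13, some 6), (13, some 7)]

/-! ### Machine verification of the desubstitution chain. -/

/-- The dominoes of `𝒯₅`. -/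
def dominoes5 : Dominoes :=
  let r := List.finRange 29
  (((r ×ˢ r).filter fun e => (tiles5 e.1).right = (tiles5 e.2).left).map fun e => (e.1.1, e.2.1),
    ((r ×ˢ r).filter fun e => (tiles5 e.1).top = (tiles5 e.2).bottom).map fun e => (e.1.1, e.2.1))

/-- The dominoes of the configurations `x (m + n, n)` for a tiling `x`. -/
def shear (N : ℕ) (D : Dominoes) : Dominoes :=
  (D.1, (List.range N ×ˢ List.range N).filter fun e =>
    D.1.any fun f => Nat.beq f.1 e.1 && hasPair D.2 f.2 e.2)

theorem dominoes6_eq : prune^[1] (shear 29 (prune^[5] dominoes5)) = dominoes6 := by decide +kernel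

/-- The shear prepares this step: the markers fill whole columns of the sheared configuration, which
are diagonals of the tiling by `𝒯₅`. -/
theorem isFusion6 :
    IsRowFusion true [0, 3, 4, 5, 13, 14, 15, 24, 25] stack6 0 dominoes6 dominoes7 := by
  decide +kernel
theorem isFusion7 : IsRowFusion false [0, 1, 2, 3, 4, 5, 6] stack7 1 dominoes7 dominoes8 := by
  decide +kernel
theorem isFusion8 : IsRowFusion true [0, 1, 2, 3, 4] stack8 2 dominoes8 dominoes9 := by
  decide +kernel
-- This step and the next three form a cycle that ends at `dominoes9` again; their composition is
-- the self-similarity.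
theorem isFusion9 : IsFusion true [0, 1, 6, 7, 8] stack9 2 dominoes9 dominoes10 := by
  decide +kernel
theorem isFusion10 : IsRowFusion false [0, 1, 6, 7, 8] stack10 2 dominoes10 dominoes11 := by
  decide +kernel
theorem isFusion11 : IsFusion false [0, 1, 6, 7, 8] stack11 2 dominoes11 dominoes12 := by
  decide +kernel
theorem isFusion12 : IsRowFusion true [0, 1, 6, 7, 8] stack12 2 dominoes12 dominoes9 := by
  decide +kernel

section SelfSimilarity

/-! ### The self-similarity of the tilings by `dominoes9` -/

/-- The composition of `F` with the self-similarity of the tilings by `dominoes9`. -/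
def Blocks.inflate {A : Type*} (F : Blocks A ℕ) : Blocks A ℕ :=
  (((F.vstack (stack stack9)).hstack (stack stack10)).vstack (stack stack11)).hstack (stack stack12)

/-- The substitution from the tilings by `dominoes9` to the tilings by `dominoes6`. -/
def blocks6 : Blocks ℕ ℕ :=
  (((Blocks.unit ℕ).hstack (stack stack6)).hstack (stack stack7)).hstack (stack stack8)

/-- A desubstitution: the tiling `y` is the recognizable image under `F` of a tiling by `D`. -/
def HasDesubstitution {A : Type*} (F : Blocks A ℕ) (D : Dominoes) (x : ℤ → ℤ → A) : Prop :=
  ∃ y a b, IsTiling D y ∧ F.Image y x a b ∧ Recognizes y x a b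

theorem HasDesubstitution.vstack {A : Type*} {F : Blocks A ℕ} {D D' : Dominoes} {x : ℤ → ℤ → A}
    (h : HasDesubstitution F D x) {top : Bool} {M : List ℕ} {S : List (ℕ × Option ℕ)} {k : ℕ}
    (hS : IsFusion top M S k D D') : HasDesubstitution (F.vstack (stack S)) D' x := by
  obtain ⟨y, a, b, hy, hF, hr⟩ := h
  obtain ⟨z, b', hz, hs, hr'⟩ := hS.exists_isStacking hy
  exact ⟨z, a, _, hz, hF.vstack hs, hr.trans hr'⟩

theorem HasDesubstitution.hstack {A : Type*} {F : Blocks A ℕ} {D D' : Dominoes} {x : ℤ → ℤ → A}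
    (h : HasDesubstitution F D x) {top : Bool} {M : List ℕ} {S : List (ℕ × Option ℕ)} {k : ℕ}
    (hS : IsRowFusion top M S k D D') : HasDesubstitution (F.hstack (stack S)) D' x := by
  obtain ⟨y, a, b, hy, hF, hr⟩ := h
  obtain ⟨z, a', hz, hs, hr'⟩ := hS.exists_isStacking hy.transpose
  exact ⟨_, _, b, hz.transpose, hF.hstack (z := fun m n => z n m) hs, hr.trans hr'.transpose⟩

theorem HasDesubstitution.refl {D : Dominoes} {x : ℤ → ℤ → ℕ} (h : IsTiling D x) :
    HasDesubstitution (Blocks.unit ℕ) D x :=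
  ⟨x, id, id, h, Blocks.unit_image x, Recognizes.refl x⟩

theorem hasDesubstitution_blocks6 {x : ℤ → ℤ → ℕ} (h : IsTiling dominoes6 x) :
    HasDesubstitution blocks6 dominoes9 x :=
  (((HasDesubstitution.refl h).hstack isFusion6).hstack isFusion7).hstack isFusion8

theorem HasDesubstitution.inflate {A : Type*} {F : Blocks A ℕ} {x : ℤ → ℤ → A}
    (h : HasDesubstitution F dominoes9 x) : HasDesubstitution F.inflate dominoes9 x :=
  (((h.vstack isFusion9).hstack isFusion10).vstack isFusion11).hstack isFusion12

/-- The blocks of the self-similarity. -/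
abbrev inflation : Blocks ℕ ℕ := (Blocks.unit ℕ).inflate

theorem two_le_inflation : ∀ c < 14, 2 ≤ inflation.width c ∧ 2 ≤ inflation.height c := by
  decide +kernel

theorem IsTiling.lt {x : ℤ → ℤ → ℕ} (h : IsTiling dominoes9 x) (m n : ℤ) : x m n < 14 :=
  (by decide : ∀ e ∈ dominoes9.1, e.1 < 14) _ (h m n).1

theorem exists_inflation {x : ℤ → ℤ → ℕ} (h : IsTiling dominoes9 x) :
    ∃ y a b, IsTiling dominoes9 y ∧ inflation.Image y x a b ∧ Recognizes y x a b ∧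
      (∀ m, a m + (2 : ℕ) ≤ a (m + 1)) ∧ ∀ n, b n + (2 : ℕ) ≤ b (n + 1) := by
  obtain ⟨y, a, b, hy, hF, hr⟩ := (HasDesubstitution.refl h).inflate
  refine ⟨y, a, b, hy, hF, hr, fun m => ?_, fun n => ?_⟩
  · have := (two_le_inflation _ (hy.lt m 0)).1
    rw [hF.width m 0]
    exact_mod_cast Int.add_le_add_left (Int.ofNat_le.2 this) _
  · have := (two_le_inflation _ (hy.lt 0 n)).2
    rw [hF.height 0 n]
    exact_mod_cast Int.add_le_add_left (Int.ofNat_le.2 this) _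

theorem noPeriod_of_isTiling9 {x : ℤ → ℤ → ℕ} (h : IsTiling dominoes9 x) : NoPeriod x :=
  noPeriod_of_selfSimilar (X := {x | IsTiling dominoes9 x}) (fun _ hx => by
    obtain ⟨y, a, b, hy, -, hr, ha, hb⟩ := exists_inflation hx
    exact ⟨y, hy, a, b, hr, ha, hb⟩) x h

theorem noPeriod_of_isTiling6 {x : ℤ → ℤ → ℕ} (h : IsTiling dominoes6 x) : NoPeriod x := by
  obtain ⟨y, a, b, hy, -, hr⟩ := hasDesubstitution_blocks6 h
  exact (noPeriod_of_isTiling9 hy).of_recognizes hr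

/-! ### Squares of side two -/

/-- The square of side two at `(p, q)`: lower left, lower right, upper left, upper right. -/
def squareAt (x : ℤ → ℤ → ℕ) (p q : ℤ) : (ℕ × ℕ) × ℕ × ℕ :=
  ((x p q, x (p + 1) q), x p (q + 1), x (p + 1) (q + 1))

/-- The letter at `(i, j)` of the image of a square. -/
def inflatedLetter (s : (ℕ × ℕ) × ℕ × ℕ) (i j : ℕ) : ℕ :=
  let w := inflation.width s.1.1
  let h := inflation.height s.1.1
  if j < h then if i < w then inflation.letter s.1.1 i j else inflation.letter s.1.2 (i - w) j
  else if i < w then inflation.letter s.2.1 i (j - h) else inflation.letter s.2.2 (i - w) (j - h)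

/-- The squares in the image of a square whose lower left letters are in the image of the lower
left letter. -/
def inflatedSquares (s : (ℕ × ℕ) × ℕ × ℕ) : List ((ℕ × ℕ) × ℕ × ℕ) :=
  (List.range (inflation.width s.1.1)).flatMap fun i =>
    (List.range (inflation.height s.1.1)).map fun j =>
      ((inflatedLetter s i j, inflatedLetter s (i + 1) j),
        inflatedLetter s i (j + 1), inflatedLetter s (i + 1) (j + 1))

/-- The squares that respect the dominoes `D`. -/
def allowedSquares (D : Dominoes) : List ((ℕ × ℕ) × ℕ × ℕ) :=
  (D.1 ×ˢ D.1).filter fun s => hasPair D.2 s.1.1 s.2.1 && hasPair D.2 s.1.2 s.2.2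

theorem squareAt_mem {D : Dominoes} {x : ℤ → ℤ → ℕ} (h : IsTiling D x) (p q : ℤ) :
    squareAt x p q ∈ allowedSquares D := by
  simp only [allowedSquares, squareAt, List.mem_filter, List.mem_product, Bool.and_eq_true,
    hasPair_iff]
  exact ⟨⟨(h _ _).1, (h _ _).1⟩, (h _ _).2, (h _ _).2⟩

theorem inflatedLetter_squareAt {x y : ℤ → ℤ → ℕ} {a b : ℤ → ℤ} (h : inflation.Image y x a b)
    (ha : ∀ m, a m + (2 : ℕ) ≤ a (m + 1)) (hb : ∀ n, b n + (2 : ℕ) ≤ b (n + 1)) (p q : ℤ) {i j : ℕ}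
    (hi : i < inflation.width (y p q) + 2) (hj : j < inflation.height (y p q) + 2) :
    x (a p + i) (b q + j) = inflatedLetter (squareAt y p q) i j := by
  have w1 := h.width p q
  have w2 := h.width p (q + 1)
  have w3 := h.width (p + 1) q
  have w4 := h.width (p + 1) (q + 1)
  have v1 := h.height p q
  have v2 := h.height p (q + 1)
  have v3 := h.height (p + 1) q
  have v4 := h.height (p + 1) (q + 1)
  have ha' := ha (p + 1)
  have hb' := hb (q + 1)
  simp only [inflatedLetter, squareAt]
  by_cases c1 : j < inflation.height (y p q) <;> by_cases c2 : i < inflation.width (y p q) <;>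
    simp only [c1, c2, if_true, if_false]
  · exact h.letter p q i j c2 c1
  · rw [← h.letter (p + 1) q (i - inflation.width (y p q)) j (by omega) (by omega)]
    congr 1; omega
  · rw [← h.letter p (q + 1) i (j - inflation.height (y p q)) (by omega) (by omega)]
    congr 1; omega
  · rw [← h.letter (p + 1) (q + 1) (i - inflation.width (y p q)) (j - inflation.height (y p q))
      (by omega) (by omega)]
    congr 1 <;> omega

theorem squareAt_eq {x y : ℤ → ℤ → ℕ} {a b : ℤ → ℤ} (h : inflation.Image y x a b)
    (ha : ∀ m, a m + (2 : ℕ) ≤ a (m + 1)) (hb : ∀ n, b n + (2 : ℕ) ≤ b (n + 1)) (p q : ℤ) {i j : ℕ}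
    (hi : i < inflation.width (y p q)) (hj : j < inflation.height (y p q)) :
    squareAt x (a p + i) (b q + j) = let s := squareAt y p q
      ((inflatedLetter s i j, inflatedLetter s (i + 1) j),
        inflatedLetter s i (j + 1), inflatedLetter s (i + 1) (j + 1)) := by
  have key := @inflatedLetter_squareAt x y a b h ha hb p q
  dsimp only
  rw [← key (i := i) (j := j) (by omega) (by omega), ← key (i := i + 1) (by omega) (by omega),
    ← key (j := j + 1) (by omega) (by omega), ← key (i := i + 1) (j := j + 1) (by omega) (by omega)]
  push_cast
  simp only [squareAt, add_assoc]

/-- Each square of a tiling comes from a square of the desubstituted tiling. -/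
theorem exists_inflatedSquares_mem {x : ℤ → ℤ → ℕ} (h : IsTiling dominoes9 x) (P Q : ℤ) :
    ∃ s ∈ allowedSquares dominoes9, squareAt x P Q ∈ inflatedSquares s := by
  obtain ⟨y, a, b, hy, hF, -, ha, hb⟩ := exists_inflation h
  obtain ⟨p, hp1, hp2⟩ := exists_cell a (fun m => by have := ha m; omega) P
  obtain ⟨q, hq1, hq2⟩ := exists_cell b (fun m => by have := hb m; omega) Q
  have w := hF.width p q
  have v := hF.height p q
  refine ⟨_, squareAt_mem hy p q, ?_⟩
  obtain ⟨i, rfl⟩ : ∃ i : ℕ, P = a p + i := ⟨(P - a p).toNat, by omega⟩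
  obtain ⟨j, rfl⟩ : ∃ j : ℕ, Q = b q + j := ⟨(Q - b q).toNat, by omega⟩
  have hi : i < inflation.width (y p q) := by omega
  have hj : j < inflation.height (y p q) := by omega
  rw [squareAt_eq hF ha hb p q hi hj]
  simp only [inflatedSquares, List.mem_flatMap, List.mem_map, List.mem_range]
  exact ⟨i, hi, j, hj, rfl⟩

/-- The squares in the `k`-fold image of the squares in a list. -/
def iteratedSquares (k : ℕ) (l : List ((ℕ × ℕ) × ℕ × ℕ)) : List ((ℕ × ℕ) × ℕ × ℕ) :=
  (fun l => l.flatMap inflatedSquares)^[k] l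

theorem squareAt_inflatedSquares {x y : ℤ → ℤ → ℕ} {a b : ℤ → ℤ} (h : inflation.Image y x a b)
    (ha : ∀ m, a m + (2 : ℕ) ≤ a (m + 1)) (hb : ∀ n, b n + (2 : ℕ) ≤ b (n + 1)) (p q : ℤ)
    {s : (ℕ × ℕ) × ℕ × ℕ} (hs : s ∈ inflatedSquares (squareAt y p q)) :
    ∃ P Q, squareAt x P Q = s := by
  simp only [inflatedSquares, List.mem_flatMap, List.mem_map, List.mem_range] at hs
  obtain ⟨i, hi, j, hj, rfl⟩ := hs
  exact ⟨_, _, squareAt_eq h ha hb p q hi hj⟩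

/-- The square `s` occurs in every tiling. -/
def OccursEverywhere (s : (ℕ × ℕ) × ℕ × ℕ) : Prop :=
  ∀ x, IsTiling dominoes9 x → ∃ p q, squareAt x p q = s

theorem OccursEverywhere.iteratedSquares {l : List ((ℕ × ℕ) × ℕ × ℕ)}
    (h : ∀ s ∈ l, OccursEverywhere s) (k : ℕ) :
    ∀ s ∈ iteratedSquares k l, OccursEverywhere s := by
  induction k with
  | zero => exact h
  | succ k ih =>
    intro s hs x hx
    rw [JeandelRao.iteratedSquares, Function.iterate_succ_apply', List.mem_flatMap] at hs
    obtain ⟨t, ht, hs⟩ := hs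
    obtain ⟨y, a, b, hy, hF, -, ha, hb⟩ := exists_inflation hx
    obtain ⟨p, q, rfl⟩ := ih t ht y hy
    exact squareAt_inflatedSquares hF ha hb p q hs

/-- Desubstitute `k` times and take any square of the resulting tiling as `s`. -/
theorem exists_forall_iteratedSquares (k : ℕ) {x : ℤ → ℤ → ℕ} (hx : IsTiling dominoes9 x) :
    ∃ s ∈ allowedSquares dominoes9, ∀ t ∈ iteratedSquares k [s], ∃ p q, squareAt x p q = t := by
  induction k generalizing x with
  | zero =>
    refine ⟨_, squareAt_mem hx 0 0, fun t ht => ⟨0, 0, ?_⟩⟩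
    simpa [iteratedSquares, eq_comm] using ht
  | succ k ih =>
    obtain ⟨y, a, b, hy, hF, -, ha, hb⟩ := exists_inflation hx
    obtain ⟨s, hs, h⟩ := ih hy
    refine ⟨s, hs, fun t ht => ?_⟩
    rw [iteratedSquares, Function.iterate_succ_apply', List.mem_flatMap] at ht
    obtain ⟨u, hu, ht⟩ := ht
    obtain ⟨p, q, rfl⟩ := h u hu
    exact squareAt_inflatedSquares hF ha hb p q ht

/-- The seed square: every tiling contains the twofold image of some allowed square, hence contains
this one. -/
theorem mem_iteratedSquares_two : ∀ s ∈ allowedSquares dominoes9,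
    ((0, 7), 3, 9) ∈ iteratedSquares 2 [s] := by decide +kernel

/-- An allowed square need not occur in a tiling, but every square that does occur lies in the image
of an allowed one. It is therefore enough that the seed generates these images. -/
theorem mem_iteratedSquares_three : ∀ s ∈ allowedSquares dominoes9, ∀ t ∈ inflatedSquares s,
    t ∈ iteratedSquares 3 [((0, 7), 3, 9)] := by decide +kernel

theorem squaresRecur9 (N : ℕ) : SquaresRecur {x | IsTiling dominoes9 x} N := by
  refine SquaresRecur.of_selfSimilar inflation ?_ (fun x hx => ?_) N
  · intro x hx z hz p q
    have h0 : OccursEverywhere ((0, 7), 3, 9) := fun x hx => by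
      obtain ⟨s, hs, h⟩ := exists_forall_iteratedSquares 2 hx
      exact h _ (mem_iteratedSquares_two s hs)
    obtain ⟨s, hs, ht⟩ := exists_inflatedSquares_mem hx p q
    obtain ⟨p', q', h⟩ := OccursEverywhere.iteratedSquares (l := [((0, 7), 3, 9)]) (by simpa) 3 _
      (mem_iteratedSquares_three s hs _ ht) z hz
    refine ⟨p', q', fun i j hi hj => ?_⟩
    simp only [squareAt, Prod.mk.injEq] at h
    interval_cases i <;> interval_cases j <;> simp [h]
  · obtain ⟨y, a, b, hy, hF, -, ha, hb⟩ := exists_inflation hx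
    exact ⟨y, hy, a, b, hF, ha, hb⟩

theorem blocks6_valid : blocks6.Valid (fun u v => (u, v) ∈ dominoes6.1)
    (fun u v => (u, v) ∈ dominoes6.2) (fun u v => (u, v) ∈ dominoes9.1)
    fun u v => (u, v) ∈ dominoes9.2 := by
  have h0 := Blocks.unit_valid (fun u v => (u, v) ∈ dominoes6.1) fun u v => (u, v) ∈ dominoes6.2
  have h1 := (IsFusion.valid isFusion6 h0.transpose).transpose
  have h2 := (IsFusion.valid isFusion7 h1.transpose).transpose
  exact (IsFusion.valid isFusion8 h2.transpose).transpose

theorem squaresRecur6 (N : ℕ) : SquaresRecur {x | IsTiling dominoes6 x} N := by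
  have h := (squaresRecur9 (N + 1)).of_image (X := {x | IsTiling dominoes6 x}) blocks6 one_pos ?_
  · exact h.mono (by omega)
  · intro x hx
    obtain ⟨y, a, b, hy, hF, -⟩ := hasDesubstitution_blocks6 hx
    refine ⟨y, hy, a, b, hF, fun m => ?_, fun n => ?_⟩
    · have : 1 ≤ blocks6.width (y m 0) := blocks6_valid.width_pos _
      rw [hF.width m 0]
      exact_mod_cast Int.add_le_add_left (Int.ofNat_le.2 this) _
    · have : 1 ≤ blocks6.height (y 0 n) := blocks6_valid.height_pos _
      rw [hF.height 0 n]
      exact_mod_cast Int.add_le_add_left (Int.ofNat_le.2 this) _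

/-! ### Large patches -/

theorem Blocks.Valid.inflate {A : Type*} {F : Blocks A ℕ} {H V : A → A → Prop}
    (h : F.Valid H V (fun u v => (u, v) ∈ dominoes9.1) fun u v => (u, v) ∈ dominoes9.2) :
    F.inflate.Valid H V (fun u v => (u, v) ∈ dominoes9.1) fun u v => (u, v) ∈ dominoes9.2 := by
  have h1 := isFusion9.valid h
  have h2 := (IsFusion.valid isFusion10 h1.transpose).transpose
  have h3 := isFusion11.valid h2
  exact (IsFusion.valid isFusion12 h3.transpose).transpose

/-- The blocks of `F` for letters less than `N` are at least `k` times as large as those of `G`. -/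
def Blocks.IsLarger {A A' : Type*} (k N : ℕ) (F : Blocks A ℕ) (G : Blocks A' ℕ) : Prop :=
  ∀ c < N, k * G.width c ≤ F.width c ∧ k * G.height c ≤ F.height c

theorem Blocks.IsLarger.transpose {A A' : Type*} {k N : ℕ} {F : Blocks A ℕ} {G : Blocks A' ℕ}
    (h : IsLarger k N F G) : IsLarger k N F.transpose G.transpose :=
  fun c hc => (h c hc).symm

/-- Sizes of stacked blocks are sums of sizes, so a common factor `k` survives stacking. -/
theorem Blocks.IsLarger.vstack {A A' : Type*} {k N : ℕ} {F : Blocks A ℕ} {G : Blocks A' ℕ}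
    (h : IsLarger k N F G) {S : List (ℕ × Option ℕ)} (hN : N ≤ S.length)
    (hS : ∀ e ∈ S, e.1 < N ∧ ∀ v ∈ e.2.toList, v < N) :
    IsLarger k N (F.vstack (stack S)) (G.vstack (stack S)) := by
  intro c hc
  obtain ⟨h1, h2⟩ := hS _ (stack_mem (hc.trans_le hN))
  refine ⟨(h _ h1).1, ?_⟩
  simp only [Blocks.vstack, mul_add]
  refine add_le_add (h _ h1).2 ?_
  cases e : (stack S c).2 with
  | none => simp
  | some v => exact (h v (h2 v (by simp [e]))).2

theorem Blocks.IsLarger.inflate {A A' : Type*} {k : ℕ} {F : Blocks A ℕ} {G : Blocks A' ℕ}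
    (h : IsLarger k 14 F G) : IsLarger k 14 F.inflate G.inflate :=
  (((h.vstack (S := stack9) (by decide) (by decide)).transpose.vstack (S := stack10) (by decide)
    (by decide)).transpose.vstack (S := stack11) (by decide) (by decide)).transpose.vstack
      (S := stack12) (by decide) (by decide) |>.transpose

/-- Compare `F` with the trivial substitution scaled by `k`: the blocks of `F.inflate` are then at
least `k` times those of `inflation`, whose sides are at least two. -/
theorem Blocks.le_inflate {A : Type*} {F : Blocks A ℕ} {k : ℕ}
    (h : ∀ c < 14, k ≤ F.width c ∧ k ≤ F.height c) :
    ∀ c < 14, 2 * k ≤ F.inflate.width c ∧ 2 * k ≤ F.inflate.height c := by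
  intro c hc
  have h1 : IsLarger k 14 F (unit ℕ) := fun c hc => by simpa [unit] using h c hc
  obtain ⟨h2, h3⟩ := h1.inflate c hc
  obtain ⟨h4, h5⟩ := two_le_inflation c hc
  rw [mul_comm 2 k]
  exact ⟨(Nat.mul_le_mul_left k h4).trans h2, (Nat.mul_le_mul_left k h5).trans h3⟩

theorem exists_large_patch (N : ℕ) : ∃ F : Blocks ℕ ℕ,
    F.Valid (fun u v => (u, v) ∈ dominoes6.1) (fun u v => (u, v) ∈ dominoes6.2)
      (fun u v => (u, v) ∈ dominoes9.1) (fun u v => (u, v) ∈ dominoes9.2) ∧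
    ∀ c < 14, 2 ^ N ≤ F.width c ∧ 2 ^ N ≤ F.height c := by
  induction N with
  | zero => exact ⟨blocks6, blocks6_valid, fun c _ =>
      ⟨blocks6_valid.width_pos c, blocks6_valid.height_pos c⟩⟩
  | succ N ih =>
    obtain ⟨F, hF, h⟩ := ih
    refine ⟨F.inflate, hF.inflate, ?_⟩
    rw [pow_succ, mul_comm]
    exact Blocks.le_inflate h

end SelfSimilarity
/-! ### Minimal aperiodic subshifts -/

section Topology

variable {A B C : Type*}

/-- A closed, shift-invariant, nonempty set of repetitive configurations without periods. -/
structure IsRepetitive [TopologicalSpace A] (X : Set (ℤ × ℤ → A)) : Prop where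
  nonempty : X.Nonempty
  isClosed : IsClosed X
  shift_mem : ∀ k, ∀ x ∈ X, shift k x ∈ X
  squaresRecur : ∀ N, SquaresRecur (Function.curry '' X) N
  noPeriod : ∀ x ∈ X, NoPeriod (Function.curry x)

theorem shift_shift (k l : ℤ × ℤ) (x : ℤ × ℤ → A) : shift k (shift l x) = shift (k + l) x := by
  funext m; simp [shift, add_assoc]

theorem shift_zero (x : ℤ × ℤ → A) : shift 0 x = x := by funext m; simp [shift]

theorem image_shift_eq {X : Set (ℤ × ℤ → A)} (h : ∀ k, ∀ x ∈ X, shift k x ∈ X) (k : ℤ × ℤ) :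
    shift k '' X = X := by
  refine Set.Subset.antisymm (Set.image_subset_iff.2 (h k)) fun x hx => ⟨shift (-k) x, h _ x hx, ?_⟩
  rw [shift_shift, add_neg_cancel, shift_zero]

theorem exists_abs_lt (I : Finset (ℤ × ℤ)) : ∃ N : ℕ, ∀ i ∈ I, |i.1| < N ∧ |i.2| < N := by
  refine ⟨I.sup (fun i => i.1.natAbs + i.2.natAbs) + 1, fun i hi => ?_⟩
  have := Finset.le_sup (f := fun i : ℤ × ℤ => i.1.natAbs + i.2.natAbs) hi
  rw [Int.abs_eq_natAbs, Int.abs_eq_natAbs]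
  omega

/-- Every finite window of `x` occurs in a given `z ∈ Z`, so some shift of `z` agrees with `x`
there; thus `x` lies in the orbit closure of `z`, which is contained in `Z`. -/
theorem IsRepetitive.isMinimal [TopologicalSpace A] {X : Set (ℤ × ℤ → A)} (h : IsRepetitive X) :
    IsMinimal X := by
  rintro Z hZX ⟨z, hz⟩ ⟨hZ, hshift⟩
  refine Set.Subset.antisymm hZX fun x hx => ?_
  rw [← hZ.closure_eq, mem_closure_iff]
  intro O hO hxO
  obtain ⟨I, u, hu, hI⟩ := isOpen_pi_iff.1 hO x hxO
  obtain ⟨N, hN⟩ := exists_abs_lt I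
  -- The square with lower left corner `(-N, -N)` and side `2 * N` contains the window `I`.
  obtain ⟨p, q, hpq⟩ := h.squaresRecur (2 * N) _ ⟨x, hx, rfl⟩ _ ⟨z, hZX hz, rfl⟩ (-N) (-N)
  refine ⟨shift (p + N, q + N) z, hI fun i hi => ?_, ?_⟩
  · obtain ⟨h1, h2⟩ := hN i hi
    rw [abs_lt] at h1 h2
    have key := hpq (i.1 + N).toNat (i.2 + N).toNat (by omega) (by omega)
    simp only [Function.curry] at key
    rw [Int.toNat_of_nonneg (by omega), Int.toNat_of_nonneg (by omega)] at key
    have e1 : shift (p + N, q + N) z i = x i := by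
      rw [shift, show i + (p + N, q + N) = (p + (i.1 + N), q + (i.2 + N)) by
        ext <;> simp <;> ring, ← key]
      congr 1; ext <;> simp
    rw [e1]
    exact (hu i hi).2
  · rw [← hshift (p + N, q + N)]; exact ⟨z, hz, rfl⟩

theorem IsRepetitive.isAperiodicMinimalSubshiftOf [TopologicalSpace A] {X Y : Set (ℤ × ℤ → A)}
    (h : IsRepetitive X) (hY : X ⊆ Y) : IsAperiodicMinimalSubshiftOf X Y := by
  refine ⟨hY, ⟨h.isClosed, image_shift_eq h.shift_mem⟩, h.isMinimal, h.nonempty,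
    fun x hx k hk => ?_⟩
  obtain ⟨h1, h2⟩ := h.noPeriod x hx k.1 k.2 fun m n => congrFun hk (m, n)
  exact Prod.ext h1 h2

/-! ### Images under substitutions by columns -/

/-- The configurations that arise from `X` by replacing letters by columns. -/
def stackImage (s : C → B × Option B) (X : Set (ℤ × ℤ → C)) : Set (ℤ × ℤ → B) :=
  {y | ∃ x ∈ X, ∃ b, IsStacking s (Function.curry x) (Function.curry y) b}

/-- The height of a column. -/
def columnHeight (e : B × Option B) : ℕ := if e.2.isSome then 2 else 1

theorem isStacking_iff {s : C → B × Option B} {z : ℤ → ℤ → C} {y : ℤ → ℤ → B} {b : ℤ → ℤ} :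
    IsStacking s z y b ↔ ∀ m n, b (n + 1) = b n + columnHeight (s (z m n)) ∧
      y m (b n) = (s (z m n)).1 ∧ ∀ v, (s (z m n)).2 = some v → y m (b n + 1) = v := by
  have e : ∀ m n, ((columnHeight (s (z m n)) : ℕ) : ℤ) =
      if (s (z m n)).2.isSome then 2 else 1 := fun m n => by
    unfold columnHeight; split_ifs <;> rfl
  exact ⟨fun h m n => ⟨by rw [e, h.height m n], h.fst m n, h.snd m n⟩, fun h =>
    ⟨fun m n => by rw [← e, (h m n).1], fun m n => (h m n).2.1, fun m n => (h m n).2.2⟩⟩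

theorem isImage_column_iff {s : C → B × Option B} {x : ℤ × ℤ → C} {y : ℤ × ℤ → B} :
    IsImage (fun c => Word.column ((s c).1 :: (s c).2.toList)) x y ↔
      ∃ b : ℤ → ℤ, b 0 = 0 ∧ IsStacking s (Function.curry x) (Function.curry y) b := by
  have hl : ∀ c, ((s c).1 :: (s c).2.toList).length = columnHeight (s c) := fun c => by
    unfold columnHeight
    cases (s c).2 <;> simp
  constructor
  · rintro ⟨a, b, a0, b0, h⟩
    have ha : ∀ m, a m = m := by
      intro m
      induction m using Int.induction_on with
      | zero => exact a0
      | succ m ih => rw [(h _ 0).1, ih]; simp [Word.column]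
      | pred m ih =>
        have := (h (-m - 1) 0).1
        rw [sub_add_cancel, ih] at this
        simp only [Word.column] at this
        push_cast at this
        omega
    refine ⟨b, b0, isStacking_iff.2 fun m n => ⟨?_, ?_, fun v hv => ?_⟩⟩
    · rw [(h m n).2.1]
      simp only [Word.column, hl, Function.curry]
    · have := (h m n).2.2 ⟨0, Nat.one_pos⟩ ⟨0, by simp [Word.column]⟩
      rw [ha] at this
      simpa [Word.column] using this
    · simp only [Function.curry] at hv
      have := (h m n).2.2 ⟨0, Nat.one_pos⟩ ⟨1, by simp [Word.column, hv]⟩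
      rw [ha] at this
      simpa [Word.column, hv] using this
  · rintro ⟨b, b0, h⟩
    refine ⟨id, b, rfl, b0, fun m n => ⟨rfl, ?_, ?_⟩⟩
    · rw [(isStacking_iff.1 h m n).1]
      simp only [Word.column, hl, Function.curry]
    · rintro ⟨i, hi⟩ ⟨j, hj⟩
      obtain rfl : i = 0 := Nat.lt_one_iff.1 hi
      have h1 := h.fst m n
      have h2 := h.snd m n
      simp only [Function.curry] at h1 h2
      rcases j with _ | _ | j
      · simpa [Word.column] using h1
      · cases e : (s (x (m, n))).2 with
        | none => simp [Word.column, e] at hj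
        | some v => simpa [Word.column, e] using h2 v e
      · exfalso
        cases e : (s (x (m, n))).2 <;> simp [Word.column, e] at hj

theorem IsStacking.shift {s : C → B × Option B} {x : ℤ × ℤ → C} {y : ℤ × ℤ → B} {b : ℤ → ℤ}
    (h : IsStacking s (Function.curry x) (Function.curry y) b) (k n₀ l : ℤ) :
    IsStacking s (Function.curry (shift (k, n₀) x)) (Function.curry (JeandelRao.shift (k, l) y))
      (fun n => b (n + n₀) - l) := by
  refine isStacking_iff.2 fun m n => ⟨?_, ?_, fun v hv => ?_⟩
  · have := (isStacking_iff.1 h (m + k) (n + n₀)).1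
    simp only [add_right_comm n 1 n₀]
    simp only [Function.curry, JeandelRao.shift, Prod.mk_add_mk] at this ⊢
    omega
  · simpa [Function.curry, JeandelRao.shift] using h.fst (m + k) (n + n₀)
  · simpa [Function.curry, JeandelRao.shift, sub_add_eq_add_sub] using h.snd (m + k) (n + n₀) v hv

/-- Closing under the shift removes exactly the normalisation `b 0 = 0` of the origin; horizontal
shifts are absorbed by `X`, because columns have width one. -/
theorem shiftClosure_morphismImage (s : C → B × Option B) {X : Set (ℤ × ℤ → C)}
    (hX : ∀ k, ∀ x ∈ X, shift k x ∈ X) :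
    shiftClosure (morphismImage (fun c => Word.column ((s c).1 :: (s c).2.toList)) X) =
      stackImage s X := by
  ext y
  simp only [shiftClosure, morphismImage, Set.mem_iUnion, Set.mem_image, Set.mem_ofPred_eq,
    isImage_column_iff]
  constructor
  · rintro ⟨⟨k, l⟩, y', ⟨x, hx, b, -, hb⟩, rfl⟩
    exact ⟨shift (k, 0) x, hX _ x hx, _, hb.shift k 0 l⟩
  · rintro ⟨x, hx, b, hb⟩
    refine ⟨(0, -b 0), shift (0, b 0) y, ⟨x, hx, _, ?_, by
      simpa [Prod.zero_eq_mk.symm, shift_zero] using hb.shift 0 0 (b 0)⟩, ?_⟩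
    · simp
    · rw [shift_shift]; simp [Prod.zero_eq_mk.symm, shift_zero]

theorem continuous_apply_of_discrete {P : Type*} [TopologicalSpace P] [TopologicalSpace B]
    {f : P → ℤ} {y : P → ℤ × ℤ → B} (hf : Continuous f) (hy : Continuous y) (m : ℤ) :
    Continuous fun p => y p (m, f p) := by
  rw [continuous_iff_continuousAt]
  intro p
  have h1 : ContinuousAt (fun q => y q (m, f p)) p :=
    ((continuous_apply (m, f p)).comp hy).continuousAt
  refine h1.congr ?_
  filter_upwards [hf.continuousAt.eventually (isOpen_discrete {f p} |>.mem_nhds rfl)] with q hq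
  rw [show f q = f p from hq]

/-- The cuts are determined by `x` up to an offset, and two offsets suffice. For each offset the
pairs `(x, y)` form a closed subset of a compact space, whose projection to `y` is compact. -/
theorem isClosed_stackImage [TopologicalSpace B] [TopologicalSpace C] [DiscreteTopology B]
    [DiscreteTopology C] [Finite B] [Finite C] (s : C → B × Option B) {X : Set (ℤ × ℤ → C)}
    (hX : IsClosed X) (hshift : ∀ k, ∀ x ∈ X, shift k x ∈ X) : IsClosed (stackImage s X) := by
  -- Normalised cuts read off from the column over 0. Each depends on finitely many letters of `x`,
  -- hence continuously on `x`.
  choose b b0 hb using fun x : ℤ × ℤ → C =>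
    exists_cuts fun n => columnHeight (s (x (0, n)))
  have cont : ∀ (g : C → ℤ) (i : ℤ × ℤ), Continuous fun x : ℤ × ℤ → C => g (x i) := fun g i =>
    continuous_of_discreteTopology.comp (continuous_apply i)
  have contb : ∀ n, Continuous fun x => b x n := by
    intro n
    induction n using Int.induction_on with
    | zero => simp only [b0]; exact continuous_const
    | succ n ih =>
      simp only [hb]
      exact ih.add (cont (fun c => (columnHeight (s c) : ℤ)) _)
    | pred n ih =>
      have : ∀ x, b x (-n - 1) = b x (-n) -
          columnHeight (s (x (0, -n - 1))) := fun x => by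
        have := hb x (-n - 1)
        rw [sub_add_cancel] at this
        omega
      simp only [this]
      exact ih.sub (cont (fun c => (columnHeight (s c) : ℤ)) _)
  have closed : ∀ β : ℤ, IsClosed {p : (ℤ × ℤ → C) × (ℤ × ℤ → B) | p.1 ∈ X ∧
      IsStacking s (Function.curry p.1) (Function.curry p.2) fun n => b p.1 n + β} := by
    intro β
    have e : {p : (ℤ × ℤ → C) × (ℤ × ℤ → B) | p.1 ∈ X ∧
        IsStacking s (Function.curry p.1) (Function.curry p.2) fun n => b p.1 n + β} =
        Prod.fst ⁻¹' X ∩ ((⋂ m, ⋂ n, {p | b p.1 (n + 1) =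
          b p.1 n + columnHeight (s (p.1 (m, n)))}) ∩
        ⋂ m, ⋂ n, (fun p : (ℤ × ℤ → C) × (ℤ × ℤ → B) =>
            (p.1 (m, n), p.2 (m, b p.1 n + β), p.2 (m, b p.1 n + β + 1))) ⁻¹'
          {t | t.2.1 = (s t.1).1 ∧ ∀ v, (s t.1).2 = some v → t.2.2 = v}) := by
      ext p
      simp only [Set.mem_ofPred_eq, Set.mem_inter_iff, Set.mem_preimage, Set.mem_iInter]
      rw [isStacking_iff]
      refine and_congr_right fun _ => ⟨fun h => ⟨fun m n => ?_, fun m n => (h m n).2⟩,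
        fun h m n => ⟨?_, h.2 m n⟩⟩
      · have := (h m n).1
        simp only [Function.curry] at this
        omega
      · have := h.1 m n
        simp only [Function.curry]
        omega
    rw [e]
    refine (hX.preimage continuous_fst).inter (IsClosed.inter ?_ ?_)
    · refine isClosed_iInter fun m => isClosed_iInter fun n => isClosed_eq
        ((contb _).comp continuous_fst) (((contb n).comp continuous_fst).add ?_)
      exact (cont (fun c => (columnHeight (s c) : ℤ)) (m, n)).comp continuous_fst
    · refine isClosed_iInter fun m => isClosed_iInter fun n => (isClosed_discrete _).preimage ?_
      have c1 : Continuous fun p : (ℤ × ℤ → C) × (ℤ × ℤ → B) => b p.1 n + β :=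
        ((contb n).comp continuous_fst).add continuous_const
      exact ((continuous_apply (m, n)).comp continuous_fst).prodMk
        ((continuous_apply_of_discrete c1 continuous_snd m).prodMk
          (continuous_apply_of_discrete (c1.add continuous_const) continuous_snd m))
  have img : stackImage s X = ⋃ β ∈ ({0, -1} : Set ℤ), Prod.snd ''
      {p : (ℤ × ℤ → C) × (ℤ × ℤ → B) | p.1 ∈ X ∧
        IsStacking s (Function.curry p.1) (Function.curry p.2) fun n => b p.1 n + β} := by
    ext y
    simp only [Set.mem_iUnion, Set.mem_image, Set.mem_ofPred_eq]
    constructor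
    · rintro ⟨x, hx, c, hc⟩
      obtain ⟨n₀, h1, h2⟩ := exists_cell c (fun n => hc.strictMono (by omega)) 0
      have h3 := hc.height 0 n₀
      have hc' := hc.shift 0 n₀ 0
      rw [show ((0, 0) : ℤ × ℤ) = 0 from rfl, shift_zero] at hc'
      -- After reindexing, the row of columns with index 0 covers height 0. Columns have height at
      -- most two, so this row starts at 0 or at -1.
      refine ⟨c n₀, ?_, (shift (0, n₀) x, y), ⟨hshift _ x hx, ?_⟩, rfl⟩
      · simp only [Set.mem_insert_iff, Set.mem_singleton_iff]
        split_ifs at h3 <;> omega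
      · convert hc' using 1
        funext n
        induction n using Int.induction_on with
        | zero => simp [b0]
        | succ n ih =>
          have h4 := (isStacking_iff.1 hc' 0 n).1
          have h5 := hb (shift (0, n₀) x) n
          simp only [Function.curry] at h4 ih ⊢
          omega
        | pred n ih =>
          have h4 := (isStacking_iff.1 hc' 0 (-n - 1)).1
          have h5 := hb (shift (0, n₀) x) (-n - 1)
          simp only [Function.curry, sub_add_cancel] at h4 h5 ih ⊢
          omega
    · rintro ⟨β, -, ⟨x, y⟩, ⟨hx, h⟩, rfl⟩
      exact ⟨x, hx, _, h⟩
  rw [img]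
  exact (Set.toFinite _).isClosed_biUnion fun β _ =>
    ((closed β).isCompact.image continuous_snd).isClosed

/-- No expansion is needed here: `t = 1` transfers recurrence of squares, and the markers transfer
the absence of periods. -/
theorem IsRepetitive.stackImage [TopologicalSpace B] [TopologicalSpace C] [DiscreteTopology B]
    [DiscreteTopology C] [Finite B] [Finite C] {s : C → B × Option B} {X : Set (ℤ × ℤ → C)}
    (hX : IsRepetitive X) (hne : (stackImage s X).Nonempty) {top : Bool} {M : B → Prop}
    (hM : ∀ c, Marked top M (s c)) (hs : Function.Injective s) :
    IsRepetitive (stackImage s X) := by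
  refine ⟨hne, isClosed_stackImage s hX.isClosed hX.shift_mem, ?_, fun N => ?_, ?_⟩
  · rintro ⟨k, l⟩ y ⟨x, hx, b, hb⟩
    exact ⟨_, hX.shift_mem (k, 0) x hx, _, hb.shift k 0 l⟩
  · refine ((hX.squaresRecur (N + 1)).of_image ((Blocks.unit B).vstack s) one_pos ?_).mono (K := N)
      (by omega)
    rintro _ ⟨y, ⟨x, hx, b, hb⟩, rfl⟩
    refine ⟨_, ⟨x, hx, rfl⟩, _, _, (Blocks.unit_image (Function.curry y)).vstack hb,
      fun m => by simp, fun n => ?_⟩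
    have := hb.strictMono (show n < n + 1 by omega)
    simp only [Function.comp, id]
    omega
  · rintro y ⟨x, hx, b, hb⟩
    exact (hX.noPeriod x hx).of_recognizes
      (hb.recognizes (fun _ _ => hM _) Set.univ (fun _ _ => trivial) hs.injOn)

/-- Two neighbouring cells lie either in one block, where the inner conditions apply, or across the
common edge of two adjacent blocks. -/
theorem Blocks.Valid.image {F : Blocks A B} {H₀ V₀ : A → A → Prop} {H V : B → B → Prop}
    (h : F.Valid H₀ V₀ H V) {y : ℤ → ℤ → B} {x : ℤ → ℤ → A} {a b : ℤ → ℤ} (hF : F.Image y x a b)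
    (hy : ∀ m n, H (y m n) (y (m + 1) n) ∧ V (y m n) (y m (n + 1))) (P Q : ℤ) :
    H₀ (x P Q) (x (P + 1) Q) ∧ V₀ (x P Q) (x P (Q + 1)) := by
  obtain ⟨m, hm1, hm2⟩ := exists_cell a (fun m => by
    have := hF.width m 0; have := h.width_pos (y m 0); omega) P
  obtain ⟨n, hn1, hn2⟩ := exists_cell b (fun n => by
    have := hF.height 0 n; have := h.height_pos (y 0 n); omega) Q
  have w := hF.width m n
  have v := hF.height m n
  obtain ⟨i, rfl⟩ : ∃ i : ℕ, P = a m + i := ⟨(P - a m).toNat, by omega⟩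
  obtain ⟨j, rfl⟩ : ∃ j : ℕ, Q = b n + j := ⟨(Q - b n).toNat, by omega⟩
  have hi : i < F.width (y m n) := by omega
  have hj : j < F.height (y m n) := by omega
  rw [hF.letter m n i j hi hj]
  constructor
  · rcases Nat.lt_or_ge (i + 1) (F.width (y m n)) with h1 | h1
    · have := hF.letter m n (i + 1) j h1 hj
      push_cast at this
      rw [add_assoc, this]
      exact h.innerH _ _ _ h1 hj
    · obtain ⟨h2, h3⟩ := h.hor _ _ (hy m n).1
      have := hF.letter (m + 1) n 0 j (h.width_pos _) (by omega)
      rw [show a m + i + 1 = a (m + 1) + (0 : ℕ) by push_cast; omega, this,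
        show i = F.width (y m n) - 1 by omega]
      exact h3 j hj
  · rcases Nat.lt_or_ge (j + 1) (F.height (y m n)) with h1 | h1
    · have := hF.letter m n i (j + 1) hi h1
      push_cast at this
      rw [add_assoc (b n), this]
      exact h.innerV _ _ _ hi h1
    · obtain ⟨h2, h3⟩ := h.ver _ _ (hy m n).2
      have := hF.letter m (n + 1) i 0 (by omega) (h.height_pos _)
      rw [show b n + j + 1 = b (n + 1) + (0 : ℕ) by push_cast; omega, this,
        show j = F.height (y m n) - 1 by omega]
      exact h3 i hi

end Topology

/-! ### Column substitutions between Wang shifts. -/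

/-- Horizontal adjacency of Wang tiles. -/
def TileH {n : ℕ} (T : Fin n → WangTile) (u v : Fin n) : Prop := (T u).right = (T v).left

/-- Vertical adjacency of Wang tiles. -/
def TileV {n : ℕ} (T : Fin n → WangTile) (u v : Fin n) : Prop := (T u).top = (T v).bottom

instance {n : ℕ} (T : Fin n → WangTile) : DecidableRel (TileH T) := fun _ _ => Nat.decEq _ _

instance {n : ℕ} (T : Fin n → WangTile) : DecidableRel (TileV T) := fun _ _ => Nat.decEq _ _

theorem stackImage_subset {n k : ℕ} {T : Fin n → WangTile} {T' : Fin k → WangTile}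
    {s : Fin n → Fin k × Option (Fin k)} (hs : ∀ c v, (s c).2 = some v → TileV T' (s c).1 v)
    (hH : ∀ c d, TileH T c d → StackH (TileH T') (s c) (s d))
    (hV : ∀ c d, TileV T c d → StackV (TileV T') (s c) (s d)) {X : Set (ℤ × ℤ → Fin n)}
    (hX : X ⊆ wangShift T) : stackImage s X ⊆ wangShift T' := by
  rintro y ⟨x, hx, b, hb⟩
  exact ((Blocks.unit_valid (TileH T') (TileV T')).vstack hs hH hV).image
    ((Blocks.unit_image (Function.curry y)).vstack hb) (hX hx)

/-- The bottom letter and the second letter of a list. -/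
def columnOf {k : ℕ} [NeZero k] (l : List (Fin k)) : Fin k × Option (Fin k) := (l.headD 0, l[1]?)

/-- The image under a substitution by columns, with markers `M`, of a minimal aperiodic subshift. -/
theorem IsRepetitive.shiftClosure_morphismImage {n k : ℕ} [NeZero k] (T : Fin n → WangTile)
    (T' : Fin k → WangTile) (l : Fin n → List (Fin k)) (top : Bool) (M : List (Fin k))
    (h0 : ∀ s, 0 < (l s).length)
    (h : ∀ s t, (T s).right = (T t).left → (l s).length = (l t).length)
    (hl : ∀ c, l c = (columnOf (l c)).1 :: (columnOf (l c)).2.toList)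
    (hM : ∀ c, Marked top (· ∈ M) (columnOf (l c)))
    (hinj : ∀ c d, columnOf (l c) = columnOf (l d) → c = d)
    (hin : ∀ c, ∀ v ∈ (columnOf (l c)).2.toList, TileV T' (columnOf (l c)).1 v)
    (hH : ∀ c d, TileH T c d → StackH (TileH T') (columnOf (l c)) (columnOf (l d)))
    (hV : ∀ c d, TileV T c d → StackV (TileV T') (columnOf (l c)) (columnOf (l d)))
    {X : Set (ℤ × ℤ → Fin n)} (hX : IsRepetitive X ∧ X ⊆ wangShift T) :
    IsRepetitive (shiftClosure (morphismImage (fun c => Word.column (l c)) X)) ∧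
      shiftClosure (morphismImage (fun c => Word.column (l c)) X) ⊆ wangShift T' := by
  have e : (fun c => Word.column (l c)) = fun c =>
      Word.column ((columnOf (l c)).1 :: (columnOf (l c)).2.toList) := by
    funext c; rw [← hl c]
  obtain ⟨x, hx⟩ := hX.1.nonempty
  obtain ⟨y, hy, -⟩ := existsUnique_isImage_column T l h0 h x (hX.2 hx)
  rw [e] at hy ⊢
  obtain ⟨b, -, hb⟩ := (isImage_column_iff (s := fun c => columnOf (l c))).1 hy
  rw [JeandelRao.shiftClosure_morphismImage (fun c => columnOf (l c)) hX.1.shift_mem]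
  exact ⟨hX.1.stackImage ⟨y, x, hx, b, hb⟩ hM fun c d => hinj c d,
    stackImage_subset (fun c v hv => hin c v (by simp [hv])) hH hV hX.2⟩

/-! ### The Wang shift `Ω₅` -/

theorem isTiling_dominoes5 {x : ℤ × ℤ → Fin 29} (h : x ∈ Omega5) :
    IsTiling dominoes5 fun m n => (x (m, n)).1 := by
  intro m n
  simp only [dominoes5, List.mem_map, List.mem_filter, decide_eq_true_eq]
  exact ⟨⟨(_, _), ⟨by simp, (h m n).1⟩, rfl⟩, ⟨(_, _), ⟨by simp, (h m n).2⟩, rfl⟩⟩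

/-- A vertical step in the sheared plane is a step right followed by a step up in the original one,
whence the intermediate letter in the definition of `shear`. -/
theorem IsTiling.shear {D : Dominoes} {x : ℤ → ℤ → ℕ} (h : IsTiling D x) {N : ℕ}
    (hN : ∀ m n, x m n < N) : IsTiling (shear N D) fun m n => x (m + n) n := by
  intro m n
  simp only [JeandelRao.shear, List.mem_filter, List.mem_product, List.mem_range,
    List.any_eq_true, Bool.and_eq_true, Nat.beq_eq, hasPair_iff]
  refine ⟨?_, ⟨hN _ _, hN _ _⟩, _, (h (m + n) n).1, rfl, ?_⟩
  · rw [add_right_comm]; exact (h (m + n) n).1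
  · rw [← add_assoc]; exact (h (m + n + 1) n).2

/-- The sheared configuration. -/
def sheared (x : ℤ × ℤ → Fin 29) (m n : ℤ) : ℕ := (x (m + n, n)).1

theorem isTiling_sheared {x : ℤ × ℤ → Fin 29} (h : x ∈ Omega5) :
    IsTiling dominoes6 (sheared x) := by
  rw [← dominoes6_eq]
  refine IsTiling.prune_iterate ?_ 1
  exact ((isTiling_dominoes5 h).prune_iterate 5).shear fun m n => (x (m, n)).2

theorem noPeriod_of_mem_Omega5 {x : ℤ × ℤ → Fin 29} (h : x ∈ Omega5) :
    NoPeriod (Function.curry x) := by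
  intro k l hx
  obtain ⟨h1, h2⟩ := noPeriod_of_isTiling6 (isTiling_sheared h) (k - l) l fun m n => by
    have := hx (m + n) n
    simp only [Function.curry] at this
    rw [sheared, sheared, ← this]
    congr 3
    ring
  omega

theorem squaresRecur_Omega5 (N : ℕ) : SquaresRecur (Function.curry '' Omega5) N := by
  rintro _ ⟨x, hx, rfl⟩ _ ⟨z, hz, rfl⟩ p q
  -- Sheared, a square of side `N` becomes a parallelogram inside a square of side `2 * N`; the
  -- offset `N` keeps the coordinate `i + N - j` nonnegative.
  obtain ⟨p', q', h⟩ := squaresRecur6 (2 * N) _ (isTiling_sheared hx) _ (isTiling_sheared hz)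
    (p - q - N) q
  refine ⟨p' + q' + N, q', fun i j hi hj => ?_⟩
  have key := h (i + N - j) j (by omega) (by omega)
  simp only [sheared] at key
  rw [Nat.cast_sub (by omega)] at key
  push_cast at key
  refine Fin.ext ?_
  simp only [Function.curry]
  rw [show p + i = p - q - N + (i + N - j) + (q + j) by ring,
    show p' + q' + N + i = p' + (i + N - j) + (q' + j) by ring]
  exact key

theorem isClosed_wangShift {n : ℕ} (T : Fin n → WangTile) : IsClosed (wangShift T) := by
  have e : wangShift T = ⋂ m : ℤ, ⋂ k : ℤ,
      (fun x : ℤ × ℤ → Fin n => (x (m, k), x (m + 1, k), x (m, k + 1))) ⁻¹'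
        {t | (T t.1).right = (T t.2.1).left ∧ (T t.1).top = (T t.2.2).bottom} := by
    ext x; simp [wangShift]
  rw [e]
  exact isClosed_iInter fun m => isClosed_iInter fun k => (isClosed_discrete _).preimage
    ((continuous_apply _).prodMk ((continuous_apply _).prodMk (continuous_apply _)))

/-- By compactness, a Wang shift is nonempty if there are tilings of arbitrarily large squares. -/
theorem wangShift_nonempty {n : ℕ} (T : Fin n → WangTile) (h : ∀ N : ℕ, ∃ x : ℤ × ℤ → Fin n,
    ∀ m k : ℤ, |m| ≤ N → |k| ≤ N → (T (x (m, k))).right = (T (x (m + 1, k))).left ∧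
      (T (x (m, k))).top = (T (x (m, k + 1))).bottom) : (wangShift T).Nonempty := by
  let K : ℕ → Set (ℤ × ℤ → Fin n) := fun N => ⋂ m : ℤ, ⋂ k : ℤ, ⋂ _ : |m| ≤ N, ⋂ _ : |k| ≤ N,
    (fun x : ℤ × ℤ → Fin n => (x (m, k), x (m + 1, k), x (m, k + 1))) ⁻¹'
      {t | (T t.1).right = (T t.2.1).left ∧ (T t.1).top = (T t.2.2).bottom}
  have hK : ∀ N, IsClosed (K N) := fun N => isClosed_iInter fun m => isClosed_iInter fun k =>
    isClosed_iInter fun _ => isClosed_iInter fun _ => (isClosed_discrete _).preimage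
      ((continuous_apply _).prodMk ((continuous_apply _).prodMk (continuous_apply _)))
  obtain ⟨x, hx⟩ := IsCompact.nonempty_iInter_of_sequence_nonempty_isCompact_isClosed K
    (fun N x hx => by
      simp only [K, Set.mem_iInter, Set.mem_preimage] at hx ⊢
      exact fun m k hm hk => hx m k (hm.trans (by simp)) (hk.trans (by simp)))
    (fun N => by
      obtain ⟨x, hx⟩ := h N
      refine ⟨x, ?_⟩
      simp only [K, Set.mem_iInter, Set.mem_preimage]
      exact fun m k hm hk => hx m k hm hk) (hK 0).isCompact hK
  refine ⟨x, fun m k => ?_⟩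
  have := Set.mem_iInter.1 hx (m.natAbs + k.natAbs)
  simp only [K, Set.mem_iInter, Set.mem_preimage] at this
  exact this m k (by push_cast; linarith [abs_nonneg k]) (by push_cast; linarith [abs_nonneg m])

/-- The tile of `𝒯₅` with a given index. -/
def tile5 (u : ℕ) : WangTile := tiles5 (Fin.ofNat 29 u)

theorem dominoes6_right : ∀ e ∈ dominoes6.1, (tile5 e.1).right = (tile5 e.2).left := by
  decide +kernel

/-- Needed to undo the shear: the tile above `e.2` in the original plane is reached by a step left
and then a sheared step up. The definition of `shear` provides a match for some right neighbour
only; here it holds for every one. -/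
theorem dominoes6_top : ∀ e ∈ dominoes6.1, ∀ f ∈ dominoes6.2, e.1 = f.1 →
    (tile5 e.2).top = (tile5 f.2).bottom := by
  decide +kernel

theorem Omega5_nonempty : Omega5.Nonempty := by
  refine wangShift_nonempty tiles5 fun N => ?_
  -- For `|m|, |k| ≤ N` the sheared coordinate `m - k` ranges over `[-2N, 2N]`. With the offsets
  -- used below, all coordinates are natural numbers below `6 * N + 6`, hence inside the patch. The
  -- letter 0 is an arbitrary choice.
  obtain ⟨F, hF, hN⟩ := exists_large_patch (6 * N + 6)
  obtain ⟨w, h⟩ := hN 0 (by norm_num)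
  have hlt : 6 * N + 6 < 2 ^ (6 * N + 6) := Nat.lt_two_pow_self
  refine ⟨fun p => Fin.ofNat 29 (F.letter 0 (p.1 - p.2 + 2 * N + 2).toNat (p.2 + N + 1).toNat),
    fun m k hm hk => ?_⟩
  rw [abs_le] at hm hk
  obtain ⟨i, hi⟩ : ∃ i : ℕ, m - k + 2 * N + 2 = i + 1 := ⟨(m - k + 2 * N + 1).toNat, by omega⟩
  obtain ⟨j, hj⟩ : ∃ j : ℕ, k + N + 1 = j := ⟨(k + N + 1).toNat, by omega⟩
  have h1 := hF.innerH 0 (i + 1) j (by omega) (by omega)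
  have h2 := hF.innerH 0 i j (by omega) (by omega)
  have h3 := hF.innerV 0 i j (by omega) (by omega)
  simp only
  rw [show (m - k + 2 * N + 2).toNat = i + 1 by omega, show (k + N + 1).toNat = j by omega,
    show (m + 1 - k + 2 * N + 2).toNat = i + 1 + 1 by omega,
    show (m - (k + 1) + 2 * N + 2).toNat = i by omega, show (k + 1 + N + 1).toNat = j + 1 by omega]
  exact ⟨dominoes6_right _ h1, dominoes6_top _ h2 _ h3 rfl⟩

/-! ### The subshift `X₄` -/

/-- The map `jmath` merges only tiles 22 and 23, which have the same top and differ only in the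
bottom colour. The undecorated tile below therefore fixes the decorated colour of the common edge,
which separates the two. Hence a period of `jmath ∘ x` is a period of `x`. -/
theorem jmath_injective_of_below : ∀ a b, (tiles5 a).top = (tiles5 b).bottom →
    ∀ c, jmath c = jmath a → ∀ d, (tiles5 c).top = (tiles5 d).bottom → jmath d = jmath b →
      d = b := by
  decide +kernel

theorem jmath_right : ∀ a b, (tiles5 a).right = (tiles5 b).left →
    (tiles4 (jmath a)).right = (tiles4 (jmath b)).left := by
  simp [tiles4_jmath]

theorem jmath_top : ∀ a b, (tiles5 a).top = (tiles5 b).bottom →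
    (tiles4 (jmath a)).top = (tiles4 (jmath b)).bottom := by
  intro a b h
  simp [tiles4_jmath, h]

theorem X4_subset : X4 ⊆ Omega4 := by
  rintro _ ⟨x, hx, rfl⟩ m n
  exact ⟨jmath_right _ _ (hx m n).1, jmath_top _ _ (hx m n).2⟩

theorem isRepetitive_X4 : IsRepetitive X4 := by
  refine ⟨Omega5_nonempty.image _, ?_, ?_, fun N => ?_, ?_⟩
  · have hc : Continuous fun (x : ℤ × ℤ → Fin 29) p => jmath (x p) :=
      continuous_pi fun p => continuous_of_discreteTopology.comp (continuous_apply p)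
    exact ((isClosed_wangShift tiles5).isCompact.image hc).isClosed
  · rintro ⟨k, l⟩ _ ⟨x, hx, rfl⟩
    refine ⟨shift (k, l) x, fun m n => ?_, rfl⟩
    have := hx (m + k) (n + l)
    rwa [add_right_comm m, add_right_comm n] at this
  · rintro _ ⟨_, ⟨x, hx, rfl⟩, rfl⟩ _ ⟨_, ⟨z, hz, rfl⟩, rfl⟩ p q
    obtain ⟨p', q', h⟩ := squaresRecur_Omega5 N _ ⟨x, hx, rfl⟩ _ ⟨z, hz, rfl⟩ p q
    exact ⟨p', q', fun i j hi hj => congrArg jmath (h i j hi hj)⟩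
  · rintro _ ⟨x, hx, rfl⟩ k l h
    refine noPeriod_of_mem_Omega5 hx k l fun m n => ?_
    have h1 := (hx m (n - 1)).2
    have h2 := (hx (m + k) (n - 1 + l)).2
    rw [sub_add_cancel] at h1
    rw [show n - 1 + l + 1 = n + l by ring] at h2
    exact jmath_injective_of_below _ _ h1 _ (h m (n - 1)) _ h2 (h m n)

/-! ### The subshifts `X₃, …, X₀` -/

/-- In $\omega_3$ the markers are the upper letters of the columns of height two; in the three other
morphisms they are the lower letters. -/
theorem isRepetitive_X3 : IsRepetitive X3 ∧ X3 ⊆ Omega3 :=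
  IsRepetitive.shiftClosure_morphismImage tiles4 tiles3 _ true [0, 1, 2, 3] (by decide) (by decide)
    (by decide) (by decide) (by decide) (by decide) (by decide) (by decide)
    ⟨isRepetitive_X4, X4_subset⟩

theorem isRepetitive_X2 : IsRepetitive X2 ∧ X2 ⊆ Omega2 :=
  IsRepetitive.shiftClosure_morphismImage tiles3 tiles2 _ false
    [8, 9, 10, 11, 12, 13, 14, 15, 16, 17, 18, 19] (by decide) (by decide)
    (by decide) (by decide) (by decide) (by decide) (by decide) (by decide) isRepetitive_X3

theorem isRepetitive_X1 : IsRepetitive X1 ∧ X1 ⊆ Omega1 :=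
  IsRepetitive.shiftClosure_morphismImage tiles2 tiles1 _ false [8, 9, 10, 11, 12] (by decide)
    (by decide) (by decide) (by decide) (by decide) (by decide) (by decide) (by decide)
    isRepetitive_X2

theorem isRepetitive_X0 : IsRepetitive X0 ∧ X0 ⊆ Omega0 :=
  IsRepetitive.shiftClosure_morphismImage tiles1 tiles0 _ false [0, 1] (by decide) (by decide)
    (by decide) (by decide) (by decide) (by decide) (by decide) (by decide) isRepetitive_X1

end JeandelRao

theorem mainTheorem3 :
    JeandelRao.IsAperiodicMinimalSubshiftOf JeandelRao.X0 JeandelRao.Omega0 ∧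
    JeandelRao.IsAperiodicMinimalSubshiftOf JeandelRao.X1 JeandelRao.Omega1 ∧
    JeandelRao.IsAperiodicMinimalSubshiftOf JeandelRao.X2 JeandelRao.Omega2 ∧
    JeandelRao.IsAperiodicMinimalSubshiftOf JeandelRao.X3 JeandelRao.Omega3 ∧
    JeandelRao.IsAperiodicMinimalSubshiftOf JeandelRao.X4 JeandelRao.Omega4 :=
  ⟨JeandelRao.isRepetitive_X0.1.isAperiodicMinimalSubshiftOf JeandelRao.isRepetitive_X0.2,
    JeandelRao.isRepetitive_X1.1.isAperiodicMinimalSubshiftOf JeandelRao.isRepetitive_X1.2,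
    JeandelRao.isRepetitive_X2.1.isAperiodicMinimalSubshiftOf JeandelRao.isRepetitive_X2.2,
    JeandelRao.isRepetitive_X3.1.isAperiodicMinimalSubshiftOf JeandelRao.isRepetitive_X3.2,
    JeandelRao.isRepetitive_X4.isAperiodicMinimalSubshiftOf JeandelRao.X4_subset⟩
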